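/- **Setting.** Let $p\ge 1$ and let $X\subset\mathbb R^p$ be compact. Let $e,E,M,L,\Delta>0$, $0<\delta\le\delta_0:=\frac{3e}{2Mp^{3/2}}$, and let $r>0$ be such that any two points of $X$ at distance at most $\delta_0$ are at distance less than $r$. A target is a function $d(x,y)\ge 0$, defined for $x\in X$ and $y\in X\cup B(x,r)$, with $d(x,x)=0$, such that, $H^*_x$ being the Hessian of $d(x,\cdot)$ at $x$: - (local smoothness) for each $x\in X$, $d(x,\cdot)$ is $C^3$ on the open ball $B(x,r)$ and its third partial derivatives are at most $M$ in absolute value there; - (triangle inequality) $d(x,z)\le d(x,y)+d(y,z)$ for $x,y,z\in X$; - (bounded eigenvalues) $E\,I\succeq H^*_x\succeq e\,I$ for $x\in X$; - (Hessian continuity) $\|H^*_x-H^*_{x'}\|_F\le L\|x-x'\|_2$ for $x,x'\in X$; - (non-zero distances) $\Delta_{\delta'}:=\inf\{d(x,y):x,y\in X,\ \|x-y\|_2>\delta'\}>0$ for every $\delta'>0$, and $\Delta_\delta\ge\Delta$. A learner sees $d$ only through the labels $\operatorname{sign}(d(x,y)-d(x,z))$ of triplets $(x,y,z)$ that it queries,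 $x\in X$ and $y,z\in X\cup B(x,r)$. Let $\mathcal N(X,\varepsilon,\ell_2)$ be the least size of an $\varepsilon$-cover of $X$ by points of $X$. For $\omega>0$ and constants $C_1,\dots,C_4>0$ put $$w_1=\omega^{3/2}\mathbf 1_{\omega<1}+\tfrac{C_1}{\sqrt\omega}\mathbf 1_{\omega\ge1},\quad w_2=\omega\mathbf 1_{\omega<1}+C_2\mathbf 1_{\omega\ge1},\quad w_3=\omega^2\mathbf 1_{\omega<1}+\tfrac{C_3}{\omega}\mathbf 1_{\omega\ge1},\quad w_4=\omega\mathbf 1_{\omega<1}+C_4\mathbf 1_{\omega\ge1}.$$ **Algorithm** (parameters: cover radius $\varepsilon$, error threshold $\xi$, switching threshold $\theta$, scaling factor $\rho$). 1. Take an $\varepsilon$-cover $\mathcal C\subset X$ of size $\mathcal N(X,\varepsilon,\ell_2)$. For each $x\in\mathcal C$, merge-sort $\mathcal C\setminus\{x\}$ by distance from $x$ with triplet queries; let $d_f(x,y)$ be the resulting rank of $y$ (equal ranks for ties), and $d_f(x,x)=0$. 2. For each $c\in\mathcal C$, find by comparisons $(c,c+\rho e_i,c+\rho e_j)$ a basis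 vector $y$ of (seemingly) largest distance. For each $u\in\{e_i\}\cup\{(e_i+e_j)/\sqrt2:i<j\}$, run a binary search (doubling until an upper end is found, then bisecting) on the queries $(c,c+\rho\sqrt t\,y,c+\rho u)$, with tolerance $\xi/(2p^2)$, to get $\hat c_u$. Let $H_c$ be the projection onto the positive semidefinite cone (in Frobenius norm) of the symmetric matrix $A$ with $u^\top Au=\hat c_u$ for all $u$. 3. With $c(x)$ a point of $\mathcal C$ nearest to $x$, output $$d'(x,y)=\begin{cases}d_f(c(x),c(y))+\theta & \text{if }(y-x)^\top H_{c(x)}(y-x)>\theta,\\ (y-x)^\top H_{c(x)}(y-x)&\text{otherwise.}\end{cases}$$ Let $\widehat{\mathcal M}(\theta)$ be the set of functions on $X\times X$ of the form displayed in step 3, for some finite $\mathcal C\subset X$, distance function $d_f$ on $\mathcal C$, positive semidefinite matrices $(H_c)_{c\in\mathcal C}$ and nearest-centre map $c(\cdot)$. **Theorem.** There are positive constants $D,C,C',C'',C_1,C_2,C_3,C_4$ depending only on $e,E,M,L,\Delta$ such that the following holds. For all $p\ge1$ and $\omega>0$ there is a threshold $\theta$ with $0<\theta\le\frac{4C'w_3}{p^3}$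 such that, for all $X$, $\delta$, $r$ as above, all $0<\varepsilon\le\frac{C\,w_1}{p^{3/2}}$ and all $0<\xi\le D\,w_2$, and all sufficiently small scaling factors $\rho>0$ (how small does not depend on $d$), the algorithm terminates on every target $d$, and: - its output $d'$ lies in $\widehat{\mathcal M}(\theta)$ and is triplet-equivalent to $d$ up to the multiplicative factor $1+\omega$: for $x,y,z\in X$, $d(x,y)>(1+\omega)d(x,z)$ implies $\operatorname{sign}(d'(x,y)-d'(x,z))=\operatorname{sign}(d(x,y)-d(x,z))$; - for each $c\in\mathcal C$, $\|\tau_cH^*_c-H_c\|_F\le\xi$ for some $\tau_c\in[1/E,1/e]$; - with $N=\mathcal N(X,\varepsilon,\ell_2)$, the number of triplet queries is at most $N^2\log_2N+Np^2\log_2\frac1\vartheta$ for every $0<\vartheta\le\frac{C''w_4}{p^2}\cdot\frac{\xi}{D\,w_2}$; in particular, for $\xi=Dw_2$, for every $0<\vartheta\le\frac{C''w_4}{p^2}$. -/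

import Mathlib

open scoped NNReal ENNReal Matrix.Norms.Frobenius

noncomputable section

/-- The space `ℝ^p` with the `ℓ₂` norm. -/
abbrev Pt (p : ℕ) : Type := EuclideanSpace ℝ (Fin p)

/-- The `i`-th standard basis vector. -/
def stdVec {p : ℕ} (i : Fin p) : Pt p := EuclideanSpace.single i 1

/-- The quadratic form `vᵀ A v`. -/
def quadForm {p : ℕ} (A : Matrix (Fin p) (Fin p) ℝ) (v : Pt p) : ℝ :=
  ∑ i, ∑ j, v i * A i j * v j

/-! ### Distance functions and their regularity

A distance function is given by a map `d : ℝ^p → ℝ^p → ℝ`. Only the values `d x y` with `x ∈ X` and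
`y ∈ X ∪ B(x, r)` are ever constrained or used, where `r` is the radius of the balls on which the
functions `d x` are smooth. -/

/-- `d` is a distance function on `X`: `d x y ≥ 0` and `d x x = 0`. -/
def IsDistanceOn {P : Type} (X : Set P) (d : P → P → ℝ) : Prop :=
  (∀ x ∈ X, ∀ y ∈ X, 0 ≤ d x y) ∧ ∀ x ∈ X, d x x = 0

/-- The Hessian matrix at `x` of the function `d x`. -/
def hess {p : ℕ} (d : Pt p → Pt p → ℝ) (x : Pt p) : Matrix (Fin p) (Fin p) ℝ :=
  Matrix.of fun i j => iteratedFDeriv ℝ 2 (d x) x ![stdVec i, stdVec j]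

/-- Local smoothness: each `d x`, `x ∈ X`, is defined, nonnegative and `C³` on the open ball of
radius `r` around `x`, with third partial derivatives bounded by `M` there. -/
def LocallySmooth {p : ℕ} (X : Set (Pt p)) (r M : ℝ) (d : Pt p → Pt p → ℝ) : Prop :=
  ∀ x ∈ X, (∀ y ∈ Metric.ball x r, 0 ≤ d x y) ∧
    ContDiffOn ℝ 3 (d x) (Metric.ball x r) ∧
    ∀ y ∈ Metric.ball x r, ∀ i j k : Fin p,
      |iteratedFDeriv ℝ 3 (d x) y ![stdVec i, stdVec j, stdVec k]| ≤ M

/-- The (directed) triangle inequality on `X`. -/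
def TriangleIneq {P : Type} (X : Set P) (d : P → P → ℝ) : Prop :=
  ∀ x ∈ X, ∀ y ∈ X, ∀ z ∈ X, d x z ≤ d x y + d y z

/-- Bounded eigenvalues: `hi • I ⪰ H_x ⪰ lo • I` for all `x ∈ X`. -/
def BoundedEigenvalues {p : ℕ} (X : Set (Pt p)) (lo hi : ℝ) (d : Pt p → Pt p → ℝ) : Prop :=
  ∀ x ∈ X, (hi • (1 : Matrix (Fin p) (Fin p) ℝ) - hess d x).PosSemidef ∧
    (hess d x - lo • (1 : Matrix (Fin p) (Fin p) ℝ)).PosSemidef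

/-- Hessian continuity: `‖H_x - H_x'‖_F ≤ L ‖x - x'‖₂` (the matrix norm is the Frobenius norm). -/
def HessianLipschitz {p : ℕ} (X : Set (Pt p)) (L : ℝ) (d : Pt p → Pt p → ℝ) : Prop :=
  ∀ x ∈ X, ∀ x' ∈ X, ‖hess d x - hess d x'‖ ≤ L * ‖x - x'‖

/-- `Δ_δ`, the infimum of `d x y` over `x, y ∈ X` with `‖x - y‖₂ > δ` (it is `∞` if there is no such
pair). -/
def separation {p : ℕ} (X : Set (Pt p)) (d : Pt p → Pt p → ℝ) (δ : ℝ) : ℝ≥0∞ :=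
  ⨅ x ∈ X, ⨅ y ∈ X, ⨅ _ : δ < ‖x - y‖, ENNReal.ofReal (d x y)

/-- The class of target distance functions with constants `lo`, `hi`, `M`, `L`, smoothness radius
`r` and separation at least `Δ` at scale `δ`. -/
structure IsTarget {p : ℕ} (X : Set (Pt p)) (lo hi M L r δ Δ : ℝ) (d : Pt p → Pt p → ℝ) :
    Prop where
  distance : IsDistanceOn X d
  smooth : LocallySmooth X r M d
  triangle : TriangleIneq X d
  eigenvalues : BoundedEigenvalues X lo hi d
  hessian : HessianLipschitz X L d
  nonzero : ∀ δ' : ℝ, 0 < δ' → 0 < separation X d δ'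
  separated : ENNReal.ofReal Δ ≤ separation X d δ

/-! ### Triplet comparisons -/

/-- The label of the triplet `(x, y, z)`: the sign of `d x y - d x z`. -/
def tripletLabel {P : Type} (d : P → P → ℝ) (x y z : P) : SignType :=
  SignType.sign (d x y - d x z)

/-- `d'` is triplet equivalent to `d` on `X` up to the multiplicative factor `1 + ω`. -/
def MultTripletEquiv {P : Type} (X : Set P) (ω : ℝ) (d d' : P → P → ℝ) : Prop :=
  ∀ x ∈ X, ∀ y ∈ X, ∀ z ∈ X, (1 + ω) * d x z < d x y → tripletLabel d x y z = tripletLabel d' x y z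

/-- Adaptive programs that access the target only through triplet queries `(x, y, z)`: they either
return a value or ask a query and continue depending on the label. -/
inductive QueryProg (P : Type) (α : Type) : Type where
  | ret (a : α) : QueryProg P α
  | ask (x y z : P) (k : SignType → QueryProg P α) : QueryProg P α

namespace QueryProg

variable {P α β : Type}

/-- Sequential composition. -/
protected def bind : QueryProg P α → (α → QueryProg P β) → QueryProg P β
  | ret a, f => f a
  | ask x y z k, f => ask x y z fun s => (k s).bind f

instance : Monad (QueryProg P) where
  pure := QueryProg.ret
  bind := QueryProg.bind

/-- The value returned when the queries are answered by `ℓ`. -/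
def run (ℓ : P → P → P → SignType) : QueryProg P α → α
  | ret a => a
  | ask x y z k => (k (ℓ x y z)).run ℓ

/-- The list of queries asked when they are answered by `ℓ`. -/
def queries (ℓ : P → P → P → SignType) : QueryProg P α → List (P × P × P)
  | ret _ => []
  | ask x y z k => (x, y, z) :: (k (ℓ x y z)).queries ℓ

end QueryProg

open QueryProg

/-! ### Learning a distance function on a finite set, by merge sort

A ranking of points by their distance from `x` is a list of groups, in order of increasing distance,
each group holding points at equal distance; a group is stored as a representative and the list of
its other members. -/

/-- The merge step: compare the representatives of the two leading groups. -/
def mergeGroups {P : Type} (x : P) :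
    List (P × List P) → List (P × List P) → QueryProg P (List (P × List P))
  | [], bs => ret bs
  | as, [] => ret as
  | (a, A) :: as, (b, B) :: bs => ask x a b fun s =>
      match s with
      | SignType.neg => (mergeGroups x as ((b, B) :: bs)).bind fun gs => ret ((a, A) :: gs)
      | SignType.pos => (mergeGroups x ((a, A) :: as) bs).bind fun gs => ret ((b, B) :: gs)
      | SignType.zero => (mergeGroups x as bs).bind fun gs => ret ((a, A ++ b :: B) :: gs)
termination_by as bs => as.length + bs.length

/-- Merge sort of a list of points by their distance from `x`. -/
def mergeSortFrom {P : Type} (x : P) (l : List P) : QueryProg P (List (P × List P)) :=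
  if h : l.length ≤ 1 then ret (l.map fun a => (a, []))
  else do
    let gs ← mergeSortFrom x (l.take (l.length / 2))
    let hs ← mergeSortFrom x (l.drop (l.length / 2))
    mergeGroups x gs hs
termination_by l.length
decreasing_by all_goals (simp only [List.length_take, List.length_drop]; omega)

open Classical in
/-- The position, counted from `1`, of the group of `y`. -/
def rankIn {P : Type} (gs : List (P × List P)) (y : P) : ℕ :=
  gs.findIdx (fun g => decide (y = g.1 ∨ y ∈ g.2)) + 1

open Classical in
/-- Rank the points of `C` other than `x` by their distance from `x`, for each `x` in the second
list. The distance function learned gives `y` its rank from `x`, and gives `x` itself `0`. -/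
def learnFinite {P : Type} (C : List P) : List P → QueryProg P (P → P → ℝ)
  | [] => ret fun _ _ => 0
  | x :: xs => do
      let gs ← mergeSortFrom x (C.filter fun y => decide (y ≠ x))
      let f ← learnFinite C xs
      pure (Function.update f x fun y => if y = x then 0 else (rankIn gs y : ℝ))

/-! ### Learning a local Mahalanobis matrix, by binary search

The pivot is `x`; a comparison of the vectors `u` and `v` is made through the triplet
`(x, x + ρ u, x + ρ v)` with a small scaling factor `ρ`. -/

/-- Scan the listed basis vectors for one of largest distance, starting from the candidate `b`. -/
def findMax {p : ℕ} (x : Pt p) (ρ : ℝ) : Fin p → List (Fin p) → QueryProg (Pt p) (Fin p)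
  | b, [] => ret b
  | b, i :: is => ask x (x + ρ • stdVec b) (x + ρ • stdVec i) fun s =>
      match s with
      | SignType.neg => findMax x ρ i is
      | _ => findMax x ρ b is

/-- Binary search, up to the tolerance `η`, for the ratio of the squared lengths of `u` and `y`.
The state is the lower end `lo` of the search interval, its upper end `up` (`none` for `∞`), and the
current guess `c`. The first argument caps the number of rounds; it only makes the definition
total. -/
def binarySearch {p : ℕ} (x y u : Pt p) (ρ η : ℝ) :
    ℕ → ℝ → Option ℝ → ℝ → QueryProg (Pt p) ℝ
  | 0, _, _, c => ret c
  | T + 1, lo, up, c =>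
      open Classical in
      if ∃ h, up = some h ∧ |h - lo| ≤ η then ret c
      else ask x (x + (ρ * √c) • y) (x + ρ • u) fun s =>
        match s with
        | SignType.pos => binarySearch x y u ρ η T lo (some c) ((c + lo) / 2)
        | SignType.neg => binarySearch x y u ρ η T c up
            (match up with
              | none => 2 * c
              | some h => (h + c) / 2)
        | SignType.zero => ret c

/-- The unit vectors `e_i` (for `i = j`) and `(e_i + e_j) / √2` (for `i ≠ j`). -/
def extVec {p : ℕ} (i j : Fin p) : Pt p :=
  if i = j then stdVec i else (1 / √2) • (stdVec i + stdVec j)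

/-- The `p (p + 1) / 2` index pairs `i ≤ j`. -/
def extPairs (p : ℕ) : List (Fin p × Fin p) :=
  (List.product (List.finRange p) (List.finRange p)).filter fun q => decide (q.1 ≤ q.2)

open Classical in
/-- Binary search for each of the listed unit vectors, starting with interval `[0, ∞)` and
guess `1`. -/
def learnCoeffs {p : ℕ} (x y : Pt p) (ρ η : ℝ) (T : ℕ) :
    List (Fin p × Fin p) → QueryProg (Pt p) (Fin p × Fin p → ℝ)
  | [] => ret fun _ => 0
  | q :: qs => do
      let c ← binarySearch x y (extVec q.1 q.2) ρ η T 0 none 1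
      let f ← learnCoeffs x y ρ η T qs
      pure (Function.update f q c)

/-- The symmetric matrix `A` with `uᵀ A u = ĉ_u` for all vectors `u = extVec i j`, `i ≤ j`. -/
def solveSym {p : ℕ} (f : Fin p × Fin p → ℝ) : Matrix (Fin p) (Fin p) ℝ :=
  Matrix.of fun i j =>
    if i = j then f (i, i) else f (min i j, max i j) - (f (i, i) + f (j, j)) / 2

/-- The projection onto the cone of positive semidefinite matrices: a positive semidefinite matrix
nearest to `A` in Frobenius norm. -/
def psdProj {p : ℕ} (A : Matrix (Fin p) (Fin p) ℝ) : Matrix (Fin p) (Fin p) ℝ :=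
  Classical.epsilon fun B => B.PosSemidef ∧
    ∀ B' : Matrix (Fin p) (Fin p) ℝ, B'.PosSemidef → ‖A - B‖ ≤ ‖A - B'‖

/-- Learn a Mahalanobis matrix that approximates the Hessian at `x` up to scaling. -/
def learnMahalanobis {p : ℕ} [NeZero p] (x : Pt p) (ρ η : ℝ) (T : ℕ) :
    QueryProg (Pt p) (Matrix (Fin p) (Fin p) ℝ) := do
  let b ← findMax x ρ 0 (List.finRange p)
  let f ← learnCoeffs x (stdVec b) ρ η T (extPairs p)
  pure (psdProj (solveSym f))

open Classical in
/-- Learn a Mahalanobis matrix at each of the listed centres. -/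
def learnLocal {p : ℕ} [NeZero p] (ρ η : ℝ) (T : ℕ) :
    List (Pt p) → QueryProg (Pt p) (Pt p → Matrix (Fin p) (Fin p) ℝ)
  | [] => ret fun _ => 0
  | x :: xs => do
      let A ← learnMahalanobis x ρ η T
      let f ← learnLocal ρ η T xs
      pure (Function.update f x A)

/-! ### The combined algorithm -/

/-- `C` is an `ε`-cover of `X` in `ℓ₂` distance by points of `X`, of the smallest possible size
`𝒩(X, ε, ℓ₂)`. -/
def IsMinimalCover {p : ℕ} (ε : ℝ≥0) (X : Set (Pt p)) (C : Finset (Pt p)) : Prop :=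
  (C : Set (Pt p)) ⊆ X ∧ Metric.IsCover ε X (C : Set (Pt p)) ∧
    (C.card : ℕ∞) = Metric.coveringNumber ε X

/-- `c x` is a point of `C` nearest to `x`, for each `x ∈ X`. -/
def IsNearest {p : ℕ} (X : Set (Pt p)) (C : Finset (Pt p)) (c : Pt p → Pt p) : Prop :=
  ∀ x ∈ X, c x ∈ C ∧ ∀ a ∈ C, ‖x - c x‖ ≤ ‖x - a‖

/-- The switch at the threshold `θ` between the global distance `f` on the centres and the local
squared Mahalanobis distances with matrices `A`. -/
def switchDist {p : ℕ} (θ : ℝ) (c : Pt p → Pt p) (f : Pt p → Pt p → ℝ)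
    (A : Pt p → Matrix (Fin p) (Fin p) ℝ) (x y : Pt p) : ℝ :=
  open Classical in
  if θ < quadForm (A (c x)) (y - x) then f (c x) (c y) + θ else quadForm (A (c x)) (y - x)

/-- The distance model with threshold `θ`: distance functions on `X` that switch between a distance
function on a finite set of centres and Mahalanobis distances at the centres. -/
def distanceModel {p : ℕ} (X : Set (Pt p)) (θ : ℝ) : Set (Pt p → Pt p → ℝ) :=
  {d' | ∃ (C : Finset (Pt p)) (c : Pt p → Pt p) (f : Pt p → Pt p → ℝ)
      (A : Pt p → Matrix (Fin p) (Fin p) ℝ),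
    (C : Set (Pt p)) ⊆ X ∧ IsNearest X C c ∧ IsDistanceOn (C : Set (Pt p)) f ∧
    (∀ a ∈ C, (A a).PosSemidef) ∧ ∀ x ∈ X, ∀ y ∈ X, d' x y = switchDist θ c f A x y}

/-- The query phase, for the cover `C`, scaling factor `ρ`, error threshold `ξ` for the
Mahalanobis matrices (the binary searches run with tolerance `ξ / (2 p²)`) and round cap `T`. It
returns the distance function on `C` and the Mahalanobis matrices at the points of `C`. -/
def smoothLearner {p : ℕ} [NeZero p] (C : Finset (Pt p)) (ρ ξ : ℝ) (T : ℕ) :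
    QueryProg (Pt p) ((Pt p → Pt p → ℝ) × (Pt p → Matrix (Fin p) (Fin p) ℝ)) := do
  let f ← learnFinite C.toList C.toList
  let A ← learnLocal ρ (ξ / (2 * (p : ℝ) ^ 2)) T C.toList
  pure (f, A)

/-! ### The rates in `ω` -/

def rate₁ (K ω : ℝ) : ℝ := if ω < 1 then ω ^ (3 / 2 : ℝ) else K / √ω

def rate₂ (K ω : ℝ) : ℝ := if ω < 1 then ω else K

def rate₃ (K ω : ℝ) : ℝ := if ω < 1 then ω ^ 2 else K / ω

end

/-! Near x the target is half its Hessian form. Since d(x,·) is nonnegative and vanishes at x, its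
gradient there is zero, and Taylor's formula leaves an error of at most M p^(3/2) ‖v‖³ / 6
(`LocallySmooth.abs_sub_le`). At a small scale ρ a comparison therefore compares two values of the
Hessian form up to O(ρ). Bisection then finds the form on the unit vectors e_i and (e_i + e_j)/√2,
relative to its value at the chosen basis vector (`searchSpec_binarySearch`). These values determine
a symmetric matrix, and projecting it to the cone at most doubles its error
(`IsTarget.mahalanobisSpec`).

For the equivalence (`multTripletEquiv_switchDist`) put m = min(ω, 1). Within a radius R of order m
/ p^(3/2) the learned form is 2τd up to a factor 1 ± m/4, with one τ per centre; this cannot reverse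
a gap of 1 + ω. The threshold θ is so small, against R² and Δ, that points on the local branch lie
within R of x and that points beyond R are at least as far in d as they are. So y is on the global
branch whenever z is. If both are, the gap d(x,y) - d(x,z) exceeds a multiple of ωθ/(1+ω), while
passing to the centres costs four distances of order ε²; hence the ranks of the centres are in the
right order. If only y is, then d' is above θ at y and at most θ at z. The rates have to satisfy w₃
≤ m² and w₁²(1+ω) ≤ 2ωw₃.

Merge sort costs at most N log₂ N queries per centre, ties included. A binary search takes log₂(1/η)
+ O(1) rounds at tolerance η, and C'' absorbs the constant. -/

open QueryProg

/-! ### Query programs -/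

namespace QueryProg

variable {P α β : Type}

theorem run_bind (ℓ : P → P → P → SignType) (a : QueryProg P α) (f : α → QueryProg P β) :
    (a.bind f).run ℓ = (f (a.run ℓ)).run ℓ := by
  induction a with
  | ret a => rfl
  | ask x y z k ih => exact ih _

theorem queries_bind (ℓ : P → P → P → SignType) (a : QueryProg P α) (f : α → QueryProg P β) :
    (a.bind f).queries ℓ = a.queries ℓ ++ (f (a.run ℓ)).queries ℓ := by
  induction a with
  | ret a => rfl
  | ask x y z k ih => exact congrArg ((x, y, z) :: ·) (ih _)

theorem run_monad_bind (ℓ : P → P → P → SignType) (a : QueryProg P α) (f : α → QueryProg P β) :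
    (a >>= f).run ℓ = (f (a.run ℓ)).run ℓ :=
  run_bind ℓ a f

theorem queries_monad_bind (ℓ : P → P → P → SignType) (a : QueryProg P α)
    (f : α → QueryProg P β) :
    (a >>= f).queries ℓ = a.queries ℓ ++ (f (a.run ℓ)).queries ℓ :=
  queries_bind ℓ a f

theorem run_pure (ℓ : P → P → P → SignType) (a : α) :
    (pure a : QueryProg P α).run ℓ = a := rfl

theorem queries_pure (ℓ : P → P → P → SignType) (a : α) :
    (pure a : QueryProg P α).queries ℓ = [] := rfl

theorem run_ret (ℓ : P → P → P → SignType) (a : α) :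
    (ret a : QueryProg P α).run ℓ = a := rfl

theorem queries_ret (ℓ : P → P → P → SignType) (a : α) :
    (ret a : QueryProg P α).queries ℓ = [] := rfl

theorem run_ask (ℓ : P → P → P → SignType) (x y z : P) (k : SignType → QueryProg P α) :
    (ask x y z k).run ℓ = (k (ℓ x y z)).run ℓ := rfl

theorem queries_ask (ℓ : P → P → P → SignType) (x y z : P) (k : SignType → QueryProg P α) :
    (ask x y z k).queries ℓ = (x, y, z) :: (k (ℓ x y z)).queries ℓ := rfl

end QueryProg

theorem tripletLabel_eq_neg_iff {P : Type} {d : P → P → ℝ} {x y z : P} :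
    tripletLabel d x y z = SignType.neg ↔ d x y < d x z := by
  rw [tripletLabel, SignType.neg_eq_neg_one, sign_eq_neg_one_iff, sub_neg]

theorem tripletLabel_eq_pos_iff {P : Type} {d : P → P → ℝ} {x y z : P} :
    tripletLabel d x y z = SignType.pos ↔ d x z < d x y := by
  rw [tripletLabel, SignType.pos_eq_one, sign_eq_one_iff, sub_pos]

theorem tripletLabel_eq_zero_iff {P : Type} {d : P → P → ℝ} {x y z : P} :
    tripletLabel d x y z = SignType.zero ↔ d x y = d x z := by
  rw [tripletLabel, SignType.zero_eq_zero, sign_eq_zero_iff, sub_eq_zero]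

/-! ### Merge sort -/

/-- `y` belongs to one of the groups of a ranking. -/
def MemGroups {P : Type} (gs : List (P × List P)) (y : P) : Prop :=
  ∃ g ∈ gs, y = g.1 ∨ y ∈ g.2

/-- The groups have increasing keys, and each holds points of equal key. -/
def SortedGroups {P : Type} (k : P → ℝ) (gs : List (P × List P)) : Prop :=
  gs.Pairwise (fun g h => k g.1 < k h.1) ∧ ∀ g ∈ gs, ∀ b ∈ g.2, k b = k g.1

theorem memGroups_cons {P : Type} {g : P × List P} {gs : List (P × List P)} {y : P} :
    MemGroups (g :: gs) y ↔ (y = g.1 ∨ y ∈ g.2) ∨ MemGroups gs y := by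
  simp [MemGroups]

theorem sortedGroups_cons {P : Type} {k : P → ℝ} {g : P × List P} {gs : List (P × List P)} :
    SortedGroups k (g :: gs) ↔
      (∀ h ∈ gs, k g.1 < k h.1) ∧ (∀ b ∈ g.2, k b = k g.1) ∧ SortedGroups k gs := by
  simp only [SortedGroups, List.pairwise_cons, List.mem_cons, forall_eq_or_imp]
  tauto

/-- The properties of the result of a merge step. -/
structure MergeSpec {P : Type} (d : P → P → ℝ) (x : P) (as bs : List (P × List P)) : Prop where
  sorted : SortedGroups (d x) ((mergeGroups x as bs).run (tripletLabel d))
  mem : ∀ y, MemGroups ((mergeGroups x as bs).run (tripletLabel d)) y ↔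
    MemGroups as y ∨ MemGroups bs y
  reps : ∀ g ∈ (mergeGroups x as bs).run (tripletLabel d),
    (∃ h ∈ as, h.1 = g.1) ∨ ∃ h ∈ bs, h.1 = g.1
  length_run : ((mergeGroups x as bs).run (tripletLabel d)).length ≤ as.length + bs.length
  length_queries :
    ((mergeGroups x as bs).queries (tripletLabel d)).length ≤ as.length + bs.length - 1
  queries : ∀ q ∈ (mergeGroups x as bs).queries (tripletLabel d),
    q.1 = x ∧ (∃ h ∈ as, h.1 = q.2.1) ∧ ∃ h ∈ bs, h.1 = q.2.2

/-- Each query consumes a leading group, and a tie consumes two, so ties never raise the count. The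
subtraction in the count is truncated: merging two empty rankings is free. -/
theorem mergeSpec {P : Type} (d : P → P → ℝ) (x : P) (as bs : List (P × List P))
    (has : SortedGroups (d x) as) (hbs : SortedGroups (d x) bs) : MergeSpec d x as bs := by
  induction as, bs using mergeGroups.induct with
  | case1 bs =>
    constructor <;> simp [mergeGroups, run_ret, queries_ret, hbs, MemGroups]
    exact fun a b h => ⟨b, h⟩
  | case2 as h =>
    have e : mergeGroups x as [] = ret as := by
      cases as <;> simp [mergeGroups]
    constructor <;> simp [e, run_ret, queries_ret, has, MemGroups]
    exact fun a b h => ⟨b, h⟩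
  | case3 a A as b B bs ih1 ih2 ih3 =>
    obtain ⟨ha1, ha2, ha3⟩ := sortedGroups_cons.1 has
    obtain ⟨hb1, hb2, hb3⟩ := sortedGroups_cons.1 hbs
    simp only at ha1 ha2 hb1 hb2
    rcases lt_trichotomy (d x a) (d x b) with hab | hab | hab
    · have hl := tripletLabel_eq_neg_iff.2 hab
      obtain ⟨h1, h2, h3, h4, h5, h6⟩ := ih1 ha3 hbs
      constructor
      all_goals simp only [mergeGroups, run_ask, queries_ask, hl, run_bind, queries_bind, run_ret,
        queries_ret, List.append_nil]
      · refine sortedGroups_cons.2 ⟨fun g hg => ?_, ha2, h1⟩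
        rcases h3 g hg with ⟨h, hh, e⟩ | ⟨h, hh, e⟩
        · exact e ▸ ha1 h hh
        · rw [← e]
          rcases List.mem_cons.1 hh with rfl | hh
          · exact hab
          · exact hab.trans (hb1 h hh)
      · intro y
        simp only [memGroups_cons, h2]
        tauto
      · simp only [List.mem_cons, forall_eq_or_imp, exists_eq_or_imp, true_or, true_and]
        intro g hg
        rcases h3 g hg with ⟨h, hh, e⟩ | ⟨h, hh, e⟩
        · exact .inl (.inr ⟨h, hh, e⟩)
        · simp only [List.mem_cons] at hh
          rcases hh with rfl | hh
          · exact .inr (.inl e)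
          · exact .inr (.inr ⟨h, hh, e⟩)
      · simp only [List.length_cons] at h4 ⊢
        omega
      · simp only [List.length_cons] at h5 ⊢
        omega
      · simp only [List.mem_cons, forall_eq_or_imp, exists_eq_or_imp, true_or, true_and]
        intro q hq
        obtain ⟨e, h, h'⟩ := h6 q hq
        simp only [List.mem_cons, exists_eq_or_imp] at h'
        exact ⟨e, .inr h, h'⟩
    · have hl := tripletLabel_eq_zero_iff.2 hab
      obtain ⟨h1, h2, h3, h4, h5, h6⟩ := ih3 ha3 hb3
      constructor
      all_goals simp only [mergeGroups, run_ask, queries_ask, hl, run_bind, queries_bind, run_ret,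
        queries_ret, List.append_nil]
      · refine sortedGroups_cons.2 ⟨fun g hg => ?_, fun y hy => ?_, h1⟩
        · rcases h3 g hg with ⟨h, hh, e⟩ | ⟨h, hh, e⟩
          · exact e ▸ ha1 h hh
          · exact e ▸ hab ▸ hb1 h hh
        · rcases List.mem_append.1 hy with hy | hy
          · exact ha2 y hy
          · rcases List.mem_cons.1 hy with rfl | hy
            · exact hab.symm
            · exact (hb2 y hy).trans hab.symm
      · intro y
        simp only [memGroups_cons, h2, List.mem_append, List.mem_cons]
        tauto
      · simp only [List.mem_cons, forall_eq_or_imp, exists_eq_or_imp, true_or, true_and]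
        intro g hg
        rcases h3 g hg with h | h
        · exact .inl (.inr h)
        · exact .inr (.inr h)
      · simp only [List.length_cons] at h4 ⊢
        omega
      · simp only [List.length_cons] at h5 ⊢
        omega
      · simp only [List.mem_cons, forall_eq_or_imp, exists_eq_or_imp, true_or, true_and]
        intro q hq
        obtain ⟨e, h, h'⟩ := h6 q hq
        exact ⟨e, .inr h, .inr h'⟩
    · have hl := tripletLabel_eq_pos_iff.2 hab
      obtain ⟨h1, h2, h3, h4, h5, h6⟩ := ih2 has hb3
      constructor
      all_goals simp only [mergeGroups, run_ask, queries_ask, hl, run_bind, queries_bind, run_ret,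
        queries_ret, List.append_nil]
      · refine sortedGroups_cons.2 ⟨fun g hg => ?_, hb2, h1⟩
        rcases h3 g hg with ⟨h, hh, e⟩ | ⟨h, hh, e⟩
        · rw [← e]
          rcases List.mem_cons.1 hh with rfl | hh
          · exact hab
          · exact hab.trans (ha1 h hh)
        · exact e ▸ hb1 h hh
      · intro y
        simp only [memGroups_cons, h2]
        tauto
      · simp only [List.mem_cons, forall_eq_or_imp, exists_eq_or_imp, true_or, or_true, true_and]
        intro g hg
        rcases h3 g hg with ⟨h, hh, e⟩ | ⟨h, hh, e⟩
        · simp only [List.mem_cons] at hh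
          rcases hh with rfl | hh
          · exact .inl (.inl e)
          · exact .inl (.inr ⟨h, hh, e⟩)
        · exact .inr (.inr ⟨h, hh, e⟩)
      · simp only [List.length_cons] at h4 ⊢
        omega
      · simp only [List.length_cons] at h5 ⊢
        omega
      · simp only [List.mem_cons, forall_eq_or_imp, exists_eq_or_imp, true_or, true_and]
        intro q hq
        obtain ⟨e, h, h'⟩ := h6 q hq
        simp only [List.mem_cons, exists_eq_or_imp] at h
        exact ⟨e, h, .inr h'⟩

/-- `n log₂ n` bounds the merge sort recurrence when the two parts have sizes `⌊n / 2⌋`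
and `⌈n / 2⌉`. -/
theorem mul_logb_split_le {a b : ℕ} (ha : 0 < a) (hab : a ≤ b) (hb : b ≤ a + 1) :
    (a : ℝ) * Real.logb 2 a + b * Real.logb 2 b + (a + b - 1) ≤
      (a + b) * Real.logb 2 (a + b) := by
  have ha' : (0 : ℝ) < a := by exact_mod_cast ha
  have hl2 : 0 < Real.log 2 := Real.log_pos one_lt_two
  have hl : (1 : ℝ) / 2 ≤ Real.log 2 := by
    have := Real.log_two_gt_d9
    linarith
  obtain rfl | rfl : b = a ∨ b = a + 1 := by omega
  · rw [← two_mul, ← two_mul, Real.logb_mul two_ne_zero ha'.ne', Real.logb_self_eq_one one_lt_two]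
    linarith
  · push_cast
    -- The tangent to log₂ at n / 2, where n = 2a + 1, bounds log₂ t from above.
    have key : ∀ t : ℝ, 0 < t → t * Real.logb 2 t ≤
        t * (Real.logb 2 (a + (a + 1)) - 1) + t * (2 * t / (a + (a + 1)) - 1) / Real.log 2 := by
      intro t ht
      have h1 : (0 : ℝ) < a + (a + 1) := by positivity
      have h2 := Real.log_le_sub_one_of_pos (show 0 < 2 * t / (a + (a + 1)) by positivity)
      rw [Real.log_div (by positivity) h1.ne', Real.log_mul two_ne_zero ht.ne'] at h2
      have h3 : Real.logb 2 t ≤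
          Real.logb 2 (a + (a + 1)) - 1 + (2 * t / (a + (a + 1)) - 1) / Real.log 2 := by
        rw [Real.logb, Real.logb]
        field_simp
        field_simp at h2
        linarith
      calc t * Real.logb 2 t ≤ _ := mul_le_mul_of_nonneg_left h3 ht.le
        _ = _ := by ring
    have k1 := key a ha'
    have k2 := key (a + 1) (by positivity)
    -- The excess over n (log₂ n - 1) is 1 / (n log 2) ≤ 1, paid for by the one comparison that a
    -- merge saves.
    have e : (a : ℝ) * (2 * a / (a + (a + 1)) - 1) / Real.log 2 +
        (a + 1) * (2 * (a + 1) / (a + (a + 1)) - 1) / Real.log 2 =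
        1 / ((a + (a + 1)) * Real.log 2) := by
      field_simp
      ring
    have h4 : 1 / (((a : ℝ) + (a + 1)) * Real.log 2) ≤ 1 := by
      rw [div_le_one (by positivity)]
      have : (1 : ℝ) ≤ a := by exact_mod_cast ha
      nlinarith
    linarith

/-- The properties of the result of merge sort. -/
structure MergeSortSpec {P : Type} (d : P → P → ℝ) (x : P) (l : List P) : Prop where
  sorted : SortedGroups (d x) ((mergeSortFrom x l).run (tripletLabel d))
  mem : ∀ y, MemGroups ((mergeSortFrom x l).run (tripletLabel d)) y ↔ y ∈ l
  length_run : ((mergeSortFrom x l).run (tripletLabel d)).length ≤ l.length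
  length_queries : (((mergeSortFrom x l).queries (tripletLabel d)).length : ℝ) ≤
    l.length * Real.logb 2 l.length
  queries : ∀ q ∈ (mergeSortFrom x l).queries (tripletLabel d),
    q.1 = x ∧ q.2.1 ∈ l ∧ q.2.2 ∈ l

theorem mergeSortSpec {P : Type} (d : P → P → ℝ) (x : P) (l : List P) : MergeSortSpec d x l := by
  induction hn : l.length using Nat.strong_induction_on generalizing l with
  | _ n ih =>
    subst hn
    by_cases h : l.length ≤ 1
    · have e : mergeSortFrom x l = ret (l.map fun a => (a, [])) := by
        rw [mergeSortFrom, dif_pos h]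
      have hlog : (0 : ℝ) ≤ l.length * Real.logb 2 l.length := by
        obtain h | h : l.length = 0 ∨ l.length = 1 := by omega
        all_goals simp [h]
      constructor <;> simp [e, run_ret, queries_ret, MemGroups, SortedGroups, hlog]
      match l, h with
      | [], _ => simp
      | [a], _ => simp
    · have e : mergeSortFrom x l = (mergeSortFrom x (l.take (l.length / 2))).bind fun gs =>
          (mergeSortFrom x (l.drop (l.length / 2))).bind fun hs => mergeGroups x gs hs := by
        rw [mergeSortFrom, dif_neg h]
        rfl
      have l1 : (l.take (l.length / 2)).length = l.length / 2 := by
        rw [List.length_take]; omega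
      have l2 : (l.drop (l.length / 2)).length = l.length - l.length / 2 := by
        rw [List.length_drop]
      obtain ⟨a1, a2, a3, a4, a5⟩ := ih _ (by omega) (l.take (l.length / 2)) rfl
      obtain ⟨b1, b2, b3, b4, b5⟩ := ih _ (by omega) (l.drop (l.length / 2)) rfl
      obtain ⟨m1, m2, m3, m4, m5, m6⟩ := mergeSpec d x _ _ a1 b1
      have hmem : ∀ y, y ∈ l ↔ y ∈ l.take (l.length / 2) ∨ y ∈ l.drop (l.length / 2) := fun y => by
        rw [← List.mem_append, List.take_append_drop]
      constructor
      all_goals simp only [e, run_bind, queries_bind]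
      · exact m1
      · intro y
        rw [m2, a2, b2, hmem]
      · omega
      · rw [l1] at a3 a4
        rw [l2] at b3 b4
        have hs := mul_logb_split_le (a := l.length / 2) (b := l.length - l.length / 2)
          (by omega) (by omega) (by omega)
        have hsum : ((l.length / 2 : ℕ) : ℝ) + (l.length - l.length / 2 : ℕ) = l.length := by
          exact_mod_cast (by omega : l.length / 2 + (l.length - l.length / 2) = l.length)
        rw [hsum] at hs
        have hm : (((mergeGroups x ((mergeSortFrom x (l.take (l.length / 2))).run (tripletLabel d))
            ((mergeSortFrom x (l.drop (l.length / 2))).run (tripletLabel d))).queries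
              (tripletLabel d)).length : ℝ) + 1 ≤ l.length := by
          exact_mod_cast (by omega)
        simp only [List.length_append, Nat.cast_add]
        linarith
      · intro q hq
        rw [List.mem_append, List.mem_append] at hq
        rcases hq with hq | hq | hq
        · obtain ⟨h1, h2, h3⟩ := a5 q hq
          exact ⟨h1, (hmem _).2 (.inl h2), (hmem _).2 (.inl h3)⟩
        · obtain ⟨h1, h2, h3⟩ := b5 q hq
          exact ⟨h1, (hmem _).2 (.inr h2), (hmem _).2 (.inr h3)⟩
        · obtain ⟨h1, ⟨g, hg, hg'⟩, ⟨h, hh, hh'⟩⟩ := m6 q hq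
          exact ⟨h1, (hmem _).2 (.inl ((a2 _).1 ⟨g, hg, .inl hg'.symm⟩)),
            (hmem _).2 (.inr ((b2 _).1 ⟨h, hh, .inl hh'.symm⟩))⟩

/-- A point has the key of the representative of its group, and these keys increase strictly along
the list. Ranks count from 1, so the index of the group is the rank minus 1. -/
theorem rankIn_lt_rankIn {P : Type} {k : P → ℝ} {gs : List (P × List P)}
    (hgs : SortedGroups k gs) {y z : P} (hy : MemGroups gs y) (hz : MemGroups gs z)
    (hk : k z < k y) : rankIn gs z < rankIn gs y := by
  classical
  have key : ∀ w, MemGroups gs w → ∃ h : rankIn gs w - 1 < gs.length,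
      k w = k (gs[rankIn gs w - 1]'h).1 := by
    rintro w ⟨g, hg, hw⟩
    have h : gs.findIdx (fun g => decide (w = g.1 ∨ w ∈ g.2)) < gs.length :=
      List.findIdx_lt_length_of_exists ⟨g, hg, by simpa using hw⟩
    have h' := List.findIdx_getElem (w := h)
    simp only [decide_eq_true_eq] at h'
    have e : rankIn gs w - 1 = gs.findIdx (fun g => decide (w = g.1 ∨ w ∈ g.2)) := by
      simp [rankIn]
    refine ⟨e ▸ h, ?_⟩
    simp only [e]
    rcases h' with h' | h'
    · exact congrArg k h'
    · exact hgs.2 _ (List.getElem_mem h) _ h'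
  obtain ⟨h1, e1⟩ := key y hy
  obtain ⟨h2, e2⟩ := key z hz
  by_contra! hle
  rcases (Nat.sub_le_sub_right hle 1).lt_or_eq with hlt | heq
  · have := List.pairwise_iff_getElem.1 hgs.1 _ _ h1 h2 hlt
    linarith
  · simp only [heq] at e1
    linarith

/-! ### Learning the distance function on the centres -/

/-- `f x` orders the points of `C` by their distance from `x`. -/
structure RanksFrom {P : Type} (C : List P) (d : P → P → ℝ) (f : P → P → ℝ) (x : P) : Prop where
  self : f x x = 0
  nonneg : ∀ y, 0 ≤ f x y
  one_le : ∀ y, y ≠ x → 1 ≤ f x y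
  lt : ∀ y ∈ C, ∀ z ∈ C, y ≠ x → z ≠ x → d x z < d x y → f x z < f x y

theorem learnFinite_ranksFrom {P : Type} (d : P → P → ℝ) (C l : List P) :
    ∀ x ∈ l, RanksFrom C d ((learnFinite C l).run (tripletLabel d)) x := by
  classical
  induction l with
  | nil => simp
  | cons a l ih =>
    intro x hx
    simp only [learnFinite, run_monad_bind, run_pure]
    by_cases h : x = a
    · subst h
      obtain ⟨m1, m2, -, -, -⟩ := mergeSortSpec d x (C.filter fun y => decide (y ≠ x))
      constructor
      · simp
      · intro y
        simp only [Function.update_self]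
        split_ifs <;> simp
      · intro y hy
        simp [hy, rankIn]
      · intro y hy z hz hyx hzx hlt
        simp only [Function.update_self, hyx, hzx, if_false, Nat.cast_lt]
        exact rankIn_lt_rankIn m1 ((m2 y).2 (by simp [hy, hyx])) ((m2 z).2 (by simp [hz, hzx])) hlt
    · obtain ⟨h1, h2, h3, h4⟩ := ih x ((List.mem_cons.1 hx).resolve_left h)
      constructor
      all_goals simp only [Function.update_of_ne h]
      exacts [h1, h2, h3, h4]

theorem learnFinite_queries_mem {P : Type} (ℓ : P → P → ℝ) (C l : List P) :
    ∀ q ∈ (learnFinite C l).queries (tripletLabel ℓ), q.1 ∈ l ∧ q.2.1 ∈ C ∧ q.2.2 ∈ C := by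
  classical
  induction l with
  | nil => simp [learnFinite, queries_ret]
  | cons a l ih =>
    intro q hq
    simp only [learnFinite, queries_monad_bind, queries_pure, List.append_nil,
      List.mem_append] at hq
    rcases hq with hq | hq
    · obtain ⟨h1, h2, h3⟩ := (mergeSortSpec ℓ a (C.filter fun y => decide (y ≠ a))).queries q hq
      exact ⟨by simp [h1], List.mem_of_mem_filter h2, List.mem_of_mem_filter h3⟩
    · obtain ⟨h1, h2, h3⟩ := ih q hq
      exact ⟨List.mem_cons_of_mem _ h1, h2, h3⟩

theorem learnFinite_length_queries {P : Type} (d : P → P → ℝ) (C l : List P) :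
    (((learnFinite C l).queries (tripletLabel d)).length : ℝ) ≤
      l.length * (C.length * Real.logb 2 C.length) := by
  classical
  induction l with
  | nil => simp [learnFinite, queries_ret]
  | cons a l ih =>
    simp only [learnFinite, queries_monad_bind, queries_pure, List.append_nil, List.length_append,
      Nat.cast_add, List.length_cons, Nat.cast_one]
    have h1 := (mergeSortSpec d a (C.filter fun y => decide (y ≠ a))).length_queries
    -- The pivot is left out of the sorted list, so monotonicity of n log₂ n is needed; its value at
    -- 0 is 0.
    have h2 : ∀ m n : ℕ, m ≤ n → (m : ℝ) * Real.logb 2 m ≤ n * Real.logb 2 n := by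
      intro m n hmn
      rcases m.eq_zero_or_pos with rfl | hm
      · rcases n.eq_zero_or_pos with rfl | hn
        · simp
        · have := Real.logb_nonneg one_lt_two (show (1 : ℝ) ≤ n by exact_mod_cast hn)
          simp only [Nat.cast_zero, zero_mul]
          positivity
      · have hm1 : (1 : ℝ) ≤ m := by exact_mod_cast hm
        have hmn' : (m : ℝ) ≤ n := by exact_mod_cast hmn
        exact mul_le_mul hmn' (Real.logb_le_logb_of_le one_lt_two (by linarith) hmn')
          (Real.logb_nonneg one_lt_two hm1) (by linarith)
    have h3 := h2 _ _ (List.length_filter_le (fun y => decide (y ≠ a)) C)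
    linarith

/-! ### Quadratic forms -/

theorem quadForm_smul {p : ℕ} (A : Matrix (Fin p) (Fin p) ℝ) (a : ℝ) (v : Pt p) :
    quadForm A (a • v) = a ^ 2 * quadForm A v := by
  simp only [quadForm, Finset.mul_sum, PiLp.smul_apply, smul_eq_mul]
  refine Finset.sum_congr rfl fun i _ => Finset.sum_congr rfl fun j _ => ?_
  ring

theorem quadForm_smul_left {p : ℕ} (A : Matrix (Fin p) (Fin p) ℝ) (a : ℝ) (v : Pt p) :
    quadForm (a • A) v = a * quadForm A v := by
  simp only [quadForm, Finset.mul_sum, Matrix.smul_apply, smul_eq_mul]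
  refine Finset.sum_congr rfl fun i _ => Finset.sum_congr rfl fun j _ => ?_
  ring

theorem quadForm_sub {p : ℕ} (A B : Matrix (Fin p) (Fin p) ℝ) (v : Pt p) :
    quadForm (A - B) v = quadForm A v - quadForm B v := by
  simp only [quadForm, ← Finset.sum_sub_distrib, Matrix.sub_apply]
  refine Finset.sum_congr rfl fun i _ => Finset.sum_congr rfl fun j _ => ?_
  ring

theorem quadForm_one {p : ℕ} (v : Pt p) : quadForm 1 v = ‖v‖ ^ 2 := by
  rw [EuclideanSpace.real_norm_sq_eq]
  simp [quadForm, Matrix.one_apply, sq]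

theorem Matrix.PosSemidef.quadForm_nonneg {p : ℕ} {A : Matrix (Fin p) (Fin p) ℝ}
    (hA : A.PosSemidef) (v : Pt p) : 0 ≤ quadForm A v := by
  have h := hA.dotProduct_mulVec_nonneg v.ofLp
  simp only [dotProduct, Matrix.mulVec, Finset.mul_sum, star_trivial] at h
  refine h.trans_eq (Finset.sum_congr rfl fun i _ => Finset.sum_congr rfl fun j _ => ?_)
  ring

theorem sq_frobenius_norm {p : ℕ} (A : Matrix (Fin p) (Fin p) ℝ) :
    ‖A‖ ^ 2 = ∑ i, ∑ j, A i j ^ 2 := by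
  rw [Matrix.frobenius_norm_def, ← Real.sqrt_eq_rpow, Real.sq_sqrt (by positivity)]
  simp

/-- Cauchy–Schwarz over index pairs: the Frobenius norm of v vᵀ is ‖v‖². -/
theorem abs_quadForm_le {p : ℕ} (A : Matrix (Fin p) (Fin p) ℝ) (v : Pt p) :
    |quadForm A v| ≤ ‖A‖ * ‖v‖ ^ 2 := by
  refine abs_le_of_sq_le_sq ?_ (by positivity)
  have h := Finset.sum_mul_sq_le_sq_mul_sq (Finset.univ : Finset (Fin p × Fin p))
    (fun q => A q.1 q.2) (fun q => v q.1 * v q.2)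
  simp only [Fintype.sum_prod_type, mul_pow] at h
  rw [mul_pow, sq_frobenius_norm]
  have e : (‖v‖ ^ 2) ^ 2 = ∑ i, ∑ j, v i ^ 2 * v j ^ 2 := by
    rw [EuclideanSpace.real_norm_sq_eq, sq, Finset.sum_mul_sum]
  rw [e]
  convert h using 2
  refine Finset.sum_congr rfl fun i _ => Finset.sum_congr rfl fun j _ => ?_
  ring

/-! ### Taylor expansion of the target -/

theorem sum_abs_le_sqrt_mul_norm {p : ℕ} (v : Pt p) : ∑ i, |v i| ≤ √p * ‖v‖ := by
  refine le_of_sq_le_sq ?_ (by positivity)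
  have h := sq_sum_le_card_mul_sum_sq (s := Finset.univ) (f := fun i => |v i|)
  rw [mul_pow, Real.sq_sqrt (by positivity), EuclideanSpace.real_norm_sq_eq]
  simpa using h

theorem eq_sum_smul_stdVec {p : ℕ} (v : Pt p) : v = ∑ i, v i • stdVec i := by
  ext j
  simp [stdVec, Pi.single_apply]

theorem multilinear_const_eq_sum {p n : ℕ}
    (F : ContinuousMultilinearMap ℝ (fun _ : Fin n => Pt p) ℝ) (v : Pt p) :
    F (fun _ => v) = ∑ a : Fin n → Fin p, (∏ k, v (a k)) * F fun k => stdVec (a k) := by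
  conv_lhs => rw [eq_sum_smul_stdVec v]
  rw [ContinuousMultilinearMap.map_sum]
  refine Finset.sum_congr rfl fun a _ => ?_
  rw [ContinuousMultilinearMap.map_smul_univ, smul_eq_mul]

theorem iteratedFDeriv_two_eq_quadForm {p : ℕ} (d : Pt p → Pt p → ℝ) (x v : Pt p) :
    iteratedFDeriv ℝ 2 (d x) x (fun _ => v) = quadForm (hess d x) v := by
  rw [multilinear_const_eq_sum, quadForm, ← (finTwoArrowEquiv (Fin p)).symm.sum_comp,
    Fintype.sum_prod_type]
  refine Finset.sum_congr rfl fun i _ => Finset.sum_congr rfl fun j _ => ?_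
  simp only [Fin.prod_univ_two, finTwoArrowEquiv_symm_apply, hess, Matrix.of_apply]
  have e : (fun k : Fin 2 => (stdVec (![i, j] k) : Pt p)) = ![stdVec i, stdVec j] := by
    ext k : 1
    fin_cases k <;> rfl
  rw [e]
  simp
  ring

/-- Bounds on partial derivatives control the form through the ℓ¹ norm. For n = 3, passing to ℓ₂
produces the factor p^(3/2). -/
theorem abs_multilinear_const_le {p n : ℕ} {M : ℝ}
    (F : ContinuousMultilinearMap ℝ (fun _ : Fin n => Pt p) ℝ)
    (hF : ∀ a : Fin n → Fin p, |F fun k => stdVec (a k)| ≤ M) (v : Pt p) :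
    |F fun _ => v| ≤ M * (∑ i, |v i|) ^ n := by
  rw [multilinear_const_eq_sum]
  calc _ ≤ ∑ a : Fin n → Fin p, |(∏ k, v (a k)) * F fun k => stdVec (a k)| :=
        Finset.abs_sum_le_sum_abs _ _
    _ ≤ ∑ a : Fin n → Fin p, (∏ k, |v (a k)|) * M := by
        refine Finset.sum_le_sum fun a _ => ?_
        rw [abs_mul, Finset.abs_prod]
        exact mul_le_mul_of_nonneg_left (hF a) (Finset.prod_nonneg fun _ _ => abs_nonneg _)
    _ = M * (∑ i, |v i|) ^ n := by
        rw [← Finset.sum_mul, mul_comm, Finset.sum_pow']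
        simp

/-- Taylor's formula with integral remainder. The linear term vanishes because x minimises d(x,·) on
the ball. -/
theorem LocallySmooth.abs_sub_le {p : ℕ} {X : Set (Pt p)} {r M : ℝ} {d : Pt p → Pt p → ℝ}
    (h : LocallySmooth X r M d) (hM : 0 ≤ M) (hd : IsDistanceOn X d) {x v : Pt p} (hx : x ∈ X)
    (hv : ‖v‖ < r) :
    |d x (x + v) - quadForm (hess d x) v / 2| ≤ M * (p : ℝ) ^ (3 / 2 : ℝ) / 6 * ‖v‖ ^ 3 := by
  obtain ⟨h0, h1, h2⟩ := h x hx
  have hball : ∀ t ∈ Set.Icc (0 : ℝ) 1, x + t • v ∈ Metric.ball x r := by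
    intro t ht
    rw [mem_ball_iff_norm, add_sub_cancel_left, norm_smul, Real.norm_of_nonneg ht.1]
    exact (mul_le_of_le_one_left (norm_nonneg _) ht.2).trans_lt hv
  have hr : 0 < r := (norm_nonneg v).trans_lt hv
  have hT := map_add_eq_sum_add_integral_iteratedFDeriv (f := d x) (x := x) (y := v) (n := 2)
    fun t ht => by
      have := h1.contDiffAt (Metric.isOpen_ball.mem_nhds (hball t ht))
      exact_mod_cast this
  have hmin : IsLocalMin (d x) x := by
    filter_upwards [Metric.isOpen_ball.mem_nhds (Metric.mem_ball_self hr)] with y hy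
    rw [hd.2 x hx]
    exact h0 y hy
  simp only [Finset.sum_range_succ, Finset.range_zero, Finset.sum_empty, iteratedFDeriv_zero_apply,
    iteratedFDeriv_one_apply, hmin.fderiv_eq_zero, hd.2 x hx, iteratedFDeriv_two_eq_quadForm] at hT
  have hT' : d x (x + v) - quadForm (hess d x) v / 2 =
      (∫ t in (0 : ℝ)..1, (1 - t) ^ 2 • iteratedFDeriv ℝ 3 (d x) (x + t • v) fun _ => v) / 2 := by
    rw [hT]
    simp [Nat.factorial]
    ring
  set B : ℝ := M * ((p : ℝ) ^ (3 / 2 : ℝ) * ‖v‖ ^ 3) with hB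
  have hp32 : (√p) ^ 3 = (p : ℝ) ^ (3 / 2 : ℝ) := by
    rw [Real.sqrt_eq_rpow, ← Real.rpow_natCast, ← Real.rpow_mul (by positivity)]
    norm_num
  have hbd : ∀ t ∈ Set.Icc (0 : ℝ) 1,
      |iteratedFDeriv ℝ 3 (d x) (x + t • v) fun _ => v| ≤ B := by
    intro t ht
    refine (abs_multilinear_const_le (M := M) _ (fun a => ?_) v).trans ?_
    · have e : (fun k : Fin 3 => (stdVec (a k) : Pt p)) =
          ![stdVec (a 0), stdVec (a 1), stdVec (a 2)] := by
        ext k : 1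
        fin_cases k <;> rfl
      rw [e]
      exact h2 _ (hball t ht) _ _ _
    · refine mul_le_mul_of_nonneg_left ?_ hM
      rw [← hp32, ← mul_pow]
      exact pow_le_pow_left₀ (Finset.sum_nonneg fun _ _ => abs_nonneg _)
        (sum_abs_le_sqrt_mul_norm v) 3
  have hint : |∫ t in (0 : ℝ)..1, (1 - t) ^ 2 • iteratedFDeriv ℝ 3 (d x) (x + t • v) fun _ => v| ≤
      ∫ t in (0 : ℝ)..1, (1 - t) ^ 2 * B := by
    rw [← Real.norm_eq_abs]
    refine intervalIntegral.norm_integral_le_of_norm_le zero_le_one ?_ ?_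
    · refine MeasureTheory.ae_of_all _ fun t ht => ?_
      rw [norm_smul, Real.norm_of_nonneg (sq_nonneg _)]
      exact mul_le_mul_of_nonneg_left (hbd t ⟨ht.1.le, ht.2⟩) (sq_nonneg _)
    · exact Continuous.intervalIntegrable (by fun_prop) _ _
  -- With the factor 1 / 2! of the remainder this gives the 1 / 6.
  have hval : ∫ t in (0 : ℝ)..1, (1 - t) ^ 2 * B = B / 3 := by
    rw [intervalIntegral.integral_mul_const,
      intervalIntegral.integral_comp_sub_left (fun t : ℝ => t ^ 2) 1]
    simp
    ring
  rw [hT', abs_div, abs_two]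
  rw [hval] at hint
  rw [hB] at hint
  linarith

/-! ### Projection onto the positive semidefinite cone -/

theorem isClosed_setOf_posSemidef {p : ℕ} :
    IsClosed {B : Matrix (Fin p) (Fin p) ℝ | B.PosSemidef} := by
  simp only [Matrix.posSemidef_iff_dotProduct_mulVec, Set.ofPred_and, Set.ofPred_forall]
  refine IsClosed.inter ?_ (isClosed_iInter fun v => ?_)
  · exact isClosed_eq (by fun_prop) continuous_id
  · exact isClosed_le continuous_const (by fun_prop)

/-- The cone is closed and nonempty in a finite-dimensional space, so a nearest point exists and the
choice in `psdProj` is a genuine one. -/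
theorem psdProj_spec {p : ℕ} (A : Matrix (Fin p) (Fin p) ℝ) :
    (psdProj A).PosSemidef ∧
      ∀ B : Matrix (Fin p) (Fin p) ℝ, B.PosSemidef → ‖A - psdProj A‖ ≤ ‖A - B‖ := by
  have : ProperSpace (Matrix (Fin p) (Fin p) ℝ) := FiniteDimensional.proper ℝ _
  have hex : ∃ B : Matrix (Fin p) (Fin p) ℝ, B.PosSemidef ∧
      ∀ B' : Matrix (Fin p) (Fin p) ℝ, B'.PosSemidef → ‖A - B‖ ≤ ‖A - B'‖ := by
    obtain ⟨B, hB, h⟩ := isClosed_setOf_posSemidef.exists_infDist_eq_dist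
      (⟨0, Matrix.PosSemidef.zero⟩ : {B : Matrix (Fin p) (Fin p) ℝ | B.PosSemidef}.Nonempty) A
    refine ⟨B, hB, fun B' hB' => ?_⟩
    rw [← dist_eq_norm, ← dist_eq_norm, ← h]
    exact Metric.infDist_le_dist_of_mem hB'
  exact Classical.epsilon_spec hex

/-- B competes in the minimisation, and the triangle inequality does the rest. This factor 2 is the
one in the tolerance ξ / (2 p²). -/
theorem norm_sub_psdProj_le {p : ℕ} (A : Matrix (Fin p) (Fin p) ℝ)
    {B : Matrix (Fin p) (Fin p) ℝ} (hB : B.PosSemidef) : ‖B - psdProj A‖ ≤ 2 * ‖A - B‖ := by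
  have h := (psdProj_spec A).2 B hB
  calc ‖B - psdProj A‖ = ‖(A - psdProj A) - (A - B)‖ := by congr 1; abel
    _ ≤ ‖A - psdProj A‖ + ‖A - B‖ := norm_sub_le _ _
    _ ≤ _ := by linarith

/-! ### Scanning for a longest basis vector -/

theorem findMax_spec {p : ℕ} (d : Pt p → Pt p → ℝ) (x : Pt p) (ρ : ℝ) (b : Fin p)
    (l : List (Fin p)) :
    (∀ i ∈ b :: l, d x (x + ρ • stdVec i) ≤
      d x (x + ρ • stdVec ((findMax x ρ b l).run (tripletLabel d)))) ∧
    ((findMax x ρ b l).queries (tripletLabel d)).length = l.length ∧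
    ∀ q ∈ (findMax x ρ b l).queries (tripletLabel d),
      ∃ i j : Fin p, q = (x, x + ρ • stdVec i, x + ρ • stdVec j) := by
  induction l generalizing b with
  | nil => simp [findMax, run_ret, queries_ret]
  | cons i l ih =>
    simp only [findMax, run_ask, queries_ask, List.length_cons, List.mem_cons, forall_eq_or_imp]
    -- The labels zero and pos both keep the candidate b.
    have hstay : d x (x + ρ • stdVec i) ≤ d x (x + ρ • stdVec b) → _ := fun h => by
      obtain ⟨h1, h2, h3⟩ := ih b
      simp only [List.mem_cons, forall_eq_or_imp] at h1
      exact (⟨⟨h1.1, h.trans h1.1, h1.2⟩, congrArg (· + 1) h2, ⟨b, i, rfl⟩, h3⟩ :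
        (d x (x + ρ • stdVec b) ≤
            d x (x + ρ • stdVec ((findMax x ρ b l).run (tripletLabel d))) ∧
          d x (x + ρ • stdVec i) ≤
            d x (x + ρ • stdVec ((findMax x ρ b l).run (tripletLabel d))) ∧
          ∀ j ∈ l, d x (x + ρ • stdVec j) ≤
            d x (x + ρ • stdVec ((findMax x ρ b l).run (tripletLabel d)))) ∧
        ((findMax x ρ b l).queries (tripletLabel d)).length + 1 = l.length + 1 ∧
        (∃ i' j' : Fin p, (x, x + ρ • stdVec b, x + ρ • stdVec i) =
          (x, x + ρ • stdVec i', x + ρ • stdVec j')) ∧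
        ∀ q ∈ (findMax x ρ b l).queries (tripletLabel d),
          ∃ i j : Fin p, q = (x, x + ρ • stdVec i, x + ρ • stdVec j))
    rcases lt_trichotomy (d x (x + ρ • stdVec b)) (d x (x + ρ • stdVec i)) with h | h | h
    · rw [tripletLabel_eq_neg_iff.2 h]
      obtain ⟨h1, h2, h3⟩ := ih i
      simp only [List.mem_cons, forall_eq_or_imp] at h1
      exact ⟨⟨h.le.trans h1.1, h1⟩, by simp [h2], ⟨b, i, rfl⟩, h3⟩
    · rw [tripletLabel_eq_zero_iff.2 h]
      exact hstay h.ge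
    · rw [tripletLabel_eq_pos_iff.2 h]
      exact hstay h.le

/-! ### Binary search -/

/-- The comparisons of the binary search are those of `c` with `t`, up to an error `σ`, as long as
`c` lies in `[0, 4]`. -/
def ComparesWith {p : ℕ} (d : Pt p → Pt p → ℝ) (x y u : Pt p) (ρ t σ : ℝ) : Prop :=
  ∀ c : ℝ, 0 ≤ c → c ≤ 4 →
    (d x (x + ρ • u) ≤ d x (x + (ρ * √c) • y) → t ≤ c + σ) ∧
    (d x (x + (ρ * √c) • y) ≤ d x (x + ρ • u) → c ≤ t + σ)

/-- The properties of a binary search for `t` that takes at most `n` rounds. -/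
structure SearchSpec {p : ℕ} (d : Pt p → Pt p → ℝ) (x y u : Pt p) (ρ η t : ℝ) (n : ℕ)
    (s : QueryProg (Pt p) ℝ) : Prop where
  run : |s.run (tripletLabel d) - t| ≤ η
  length_queries : (s.queries (tripletLabel d)).length ≤ n
  queries : ∀ q ∈ s.queries (tripletLabel d),
    ∃ c : ℝ, 0 ≤ c ∧ c ≤ 4 ∧ q = (x, x + (ρ * √c) • y, x + ρ • u)

theorem SearchSpec.ask {p : ℕ} {d : Pt p → Pt p → ℝ} {x y u : Pt p} {ρ η t c : ℝ} {n : ℕ}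
    {k : SignType → QueryProg (Pt p) ℝ} (hc0 : 0 ≤ c) (hc4 : c ≤ 4)
    (hk : SearchSpec d x y u ρ η t n (k (tripletLabel d x (x + (ρ * √c) • y) (x + ρ • u)))) :
    SearchSpec d x y u ρ η t (n + 1) (ask x (x + (ρ * √c) • y) (x + ρ • u) k) := by
  obtain ⟨h1, h2, h3⟩ := hk
  refine ⟨h1, ?_, ?_⟩
  · simpa only [queries_ask, List.length_cons, Nat.add_le_add_iff_right] using h2
  · simp only [queries_ask, List.mem_cons, forall_eq_or_imp]
    exact ⟨⟨c, hc0, hc4, rfl⟩, h3⟩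

theorem SearchSpec.ret {p : ℕ} {d : Pt p → Pt p → ℝ} {x y u : Pt p} {ρ η t c : ℝ} {n : ℕ}
    (h : |c - t| ≤ η) : SearchSpec d x y u ρ η t n (ret c) :=
  ⟨h, by simp [queries_ret], by simp [queries_ret]⟩

/-- The invariant is that t lies in [a - σ, b + σ] and that the guess is the midpoint. Once b - a ≤
η, the guess is within η / 2 + σ ≤ η of t. -/
theorem searchSpec_bisect {p : ℕ} {d : Pt p → Pt p → ℝ} {x y u : Pt p} {ρ η t σ : ℝ}
    (hd : ComparesWith d x y u ρ t σ) (hσ : σ ≤ η / 2) (hη : 0 ≤ η) (T k : ℕ) (hk : k ≤ T)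
    (a b : ℝ) (ha : 0 ≤ a) (hab : a ≤ b) (hb : b ≤ 4) (hw : b - a ≤ η * 2 ^ k) (hat : a ≤ t + σ)
    (hbt : t ≤ b + σ) :
    SearchSpec d x y u ρ η t k (binarySearch x y u ρ η T a (some b) ((b + a) / 2)) := by
  have hdone : b - a ≤ η → |(b + a) / 2 - t| ≤ η := fun h => by
    rw [abs_le]
    constructor <;> linarith
  induction T generalizing k a b with
  | zero =>
    obtain rfl : k = 0 := by omega
    exact .ret (hdone (by simpa using hw))
  | succ T ih =>
    rw [binarySearch]
    split_ifs with h
    · obtain ⟨b', e, h⟩ := h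
      obtain rfl : b = b' := by simpa using e
      exact .ret (hdone ((le_abs_self _).trans h))
    · have hlt : η < b - a := by
        by_contra! hle
        exact h ⟨b, rfl, by rwa [abs_of_nonneg (by linarith)]⟩
      obtain ⟨k, rfl⟩ : ∃ j, k = j + 1 := by
        refine Nat.exists_eq_succ_of_ne_zero ?_
        rintro rfl
        simp only [pow_zero, mul_one] at hw
        linarith
      rw [pow_succ] at hw
      obtain ⟨h1, h2⟩ := hd ((b + a) / 2) (by linarith) (by linarith)
      refine .ask (by linarith) (by linarith) ?_
      rcases lt_trichotomy (d x (x + (ρ * √((b + a) / 2)) • y)) (d x (x + ρ • u)) with hl | hl | hl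
      · rw [tripletLabel_eq_neg_iff.2 hl]
        exact ih k (by omega) _ _ (by linarith) (by linarith) hb (by linarith) (h2 hl.le) hbt
          fun h => by
            rw [abs_le]
            have := h2 hl.le
            constructor <;> linarith
      · rw [tripletLabel_eq_zero_iff.2 hl]
        refine .ret (abs_le.2 ?_)
        have := h1 hl.ge
        have := h2 hl.le
        constructor <;> linarith
      · rw [tripletLabel_eq_pos_iff.2 hl]
        exact ih k (by omega) _ _ ha (by linarith) (by linarith) (by linarith) hat (h1 hl.le)
          fun h => by
            rw [abs_le]
            have := h1 hl.le
            constructor <;> linarith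

/-- The doubling phase tries at most 1, 2 and 4, since t + σ < 4. It leaves an interval of length at
most 2 ≤ η 2^k, which k bisections reduce to η. -/
theorem searchSpec_binarySearch {p : ℕ} {d : Pt p → Pt p → ℝ} {x y u : Pt p} {ρ η t σ : ℝ}
    (hd : ComparesWith d x y u ρ t σ) (hσ : σ ≤ η / 2) (hη : 0 < η) (T k : ℕ)
    (hk : k + 3 ≤ T) (hkη : 2 ≤ η * 2 ^ k) (ht0 : 0 ≤ t + σ) (ht : t + σ < 4) :
    SearchSpec d x y u ρ η t (k + 3) (binarySearch x y u ρ η T 0 none 1) := by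
  obtain ⟨T, rfl⟩ : ∃ S, T = S + 3 := ⟨T - 3, by omega⟩
  have hzero : ∀ c : ℝ, 0 ≤ c → c ≤ 4 → d x (x + (ρ * √c) • y) = d x (x + ρ • u) →
      |c - t| ≤ η := fun c h0 h4 he => by
    obtain ⟨h1, h2⟩ := hd c h0 h4
    have := h1 he.ge
    have := h2 he.le
    rw [abs_le]
    constructor <;> linarith
  have hnone : ∀ (S : ℕ) (a c : ℝ), binarySearch x y u ρ η (S + 1) a none c =
      QueryProg.ask x (x + (ρ * √c) • y) (x + ρ • u) fun s =>
        match s with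
        | SignType.pos => binarySearch x y u ρ η S a (some c) ((c + a) / 2)
        | SignType.neg => binarySearch x y u ρ η S c none (2 * c)
        | SignType.zero => QueryProg.ret c := fun S a c => by
    rw [binarySearch, if_neg (by simp)]
  have hone : d x (x + (ρ * √1) • y) < d x (x + ρ • u) →
      SearchSpec d x y u ρ η t (k + 2) (binarySearch x y u ρ η (T + 2) 1 none 2) := fun hl1 => by
    have hb1 := (hd 1 (by norm_num) (by norm_num)).2 hl1.le
    rw [hnone]
    refine .ask (by norm_num) (by norm_num) ?_
    rcases lt_trichotomy (d x (x + (ρ * √2) • y)) (d x (x + ρ • u)) with hl | hl | hl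
    · rw [tripletLabel_eq_neg_iff.2 hl]
      simp only
      have hb2 := (hd 2 (by norm_num) (by norm_num)).2 hl.le
      rw [hnone]
      rw [show (2 : ℝ) * 2 = 4 by norm_num]
      refine .ask (by norm_num) (by norm_num) ?_
      rcases lt_trichotomy (d x (x + (ρ * √4) • y)) (d x (x + ρ • u)) with hl | hl | hl
      -- If 4 seemed too small, then 4 ≤ t + σ.
      · exact absurd ((hd 4 (by norm_num) le_rfl).2 hl.le) ht.not_ge
      · rw [tripletLabel_eq_zero_iff.2 hl]
        exact .ret (hzero _ (by norm_num) (by norm_num) hl)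
      · rw [tripletLabel_eq_pos_iff.2 hl]
        exact searchSpec_bisect hd hσ hη.le _ _ (by omega) _ _ (by norm_num) (by norm_num)
          (by norm_num) (by linarith) hb2 ((hd 4 (by norm_num) le_rfl).1 hl.le)
    · rw [tripletLabel_eq_zero_iff.2 hl]
      exact .ret (hzero _ (by norm_num) (by norm_num) hl)
    · rw [tripletLabel_eq_pos_iff.2 hl]
      have := searchSpec_bisect hd hσ hη.le (T + 1) k (by omega) 1 2 (by norm_num) (by norm_num)
        (by norm_num) (by linarith) hb1 ((hd 2 (by norm_num) (by norm_num)).1 hl.le)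
      exact ⟨this.run, this.length_queries.trans (by omega), this.queries⟩
  rw [hnone]
  refine .ask (by norm_num) (by norm_num) ?_
  rcases lt_trichotomy (d x (x + (ρ * √1) • y)) (d x (x + ρ • u)) with hl | hl | hl
  · rw [tripletLabel_eq_neg_iff.2 hl]
    simpa only [mul_one] using hone hl
  · rw [tripletLabel_eq_zero_iff.2 hl]
    exact .ret (hzero _ (by norm_num) (by norm_num) hl)
  · rw [tripletLabel_eq_pos_iff.2 hl]
    have := searchSpec_bisect hd hσ hη.le (T + 2) k (by omega) 0 1 (by norm_num) (by norm_num)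
      (by norm_num) (by linarith) ht0 ((hd 1 (by norm_num) (by norm_num)).1 hl.le)
    exact ⟨this.run, this.length_queries.trans (by omega), this.queries⟩

theorem exists_pow_two_mul_ge {η : ℝ} (hη : 0 < η) (hη1 : η ≤ 1) :
    ∃ k : ℕ, 2 ≤ η * 2 ^ k ∧ (k : ℝ) ≤ Real.logb 2 (1 / η) + 2 := by
  have h0 : 0 ≤ Real.logb 2 (1 / η) :=
    Real.logb_nonneg one_lt_two (by rwa [le_div_iff₀ hη, one_mul])
  refine ⟨⌈Real.logb 2 (1 / η) + 1⌉₊, ?_, ?_⟩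
  · have h := Nat.le_ceil (Real.logb 2 (1 / η) + 1)
    have h' : (2 : ℝ) ^ (Real.logb 2 (1 / η) + 1) ≤ 2 ^ (⌈Real.logb 2 (1 / η) + 1⌉₊ : ℝ) :=
      Real.rpow_le_rpow_of_exponent_le one_le_two h
    rw [Real.rpow_add two_pos, Real.rpow_logb two_pos (by norm_num) (by positivity),
      Real.rpow_one, Real.rpow_natCast] at h'
    calc (2 : ℝ) = η * (1 / η * 2) := by field_simp
      _ ≤ _ := mul_le_mul_of_nonneg_left h' hη.le
  · have := (Nat.ceil_lt_add_one (show 0 ≤ Real.logb 2 (1 / η) + 1 by linarith)).le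
    linarith

/-- The properties of the binary searches for all listed index pairs. -/
theorem learnCoeffs_spec {p : ℕ} {d : Pt p → Pt p → ℝ} {x y : Pt p} {ρ η : ℝ} {T n : ℕ}
    {t : Fin p × Fin p → ℝ} (l : List (Fin p × Fin p))
    (h : ∀ q ∈ l, SearchSpec d x y (extVec q.1 q.2) ρ η (t q) n
      (binarySearch x y (extVec q.1 q.2) ρ η T 0 none 1)) :
    (∀ q ∈ l, |(learnCoeffs x y ρ η T l).run (tripletLabel d) q - t q| ≤ η) ∧
    ((learnCoeffs x y ρ η T l).queries (tripletLabel d)).length ≤ l.length * n ∧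
    ∀ q ∈ (learnCoeffs x y ρ η T l).queries (tripletLabel d),
      ∃ (i j : Fin p) (c : ℝ), 0 ≤ c ∧ c ≤ 4 ∧
        q = (x, x + (ρ * √c) • y, x + ρ • extVec i j) := by
  classical
  induction l with
  | nil => simp [learnCoeffs, queries_ret]
  | cons a l ih =>
    obtain ⟨h1, h2, h3⟩ := ih fun q hq => h q (List.mem_cons_of_mem _ hq)
    obtain ⟨s1, s2, s3⟩ := h a List.mem_cons_self
    simp only [learnCoeffs, run_monad_bind, queries_monad_bind, run_pure, queries_pure,
      List.append_nil, List.length_append, List.length_cons, List.mem_append]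
    refine ⟨fun q hq => ?_, by linarith, ?_⟩
    · by_cases hqa : q = a
      · subst hqa
        simpa using s1
      · rw [Function.update_of_ne hqa]
        exact h1 q ((List.mem_cons.1 hq).resolve_left hqa)
    · rintro q (hq | hq)
      · obtain ⟨c, h⟩ := s3 q hq
        exact ⟨_, _, c, h⟩
      · exact h3 q hq

/-! ### The unit vectors of the binary searches -/

theorem norm_stdVec {p : ℕ} (i : Fin p) : ‖(stdVec i : Pt p)‖ = 1 := by
  simp [stdVec]

theorem quadForm_stdVec {p : ℕ} (A : Matrix (Fin p) (Fin p) ℝ) (i : Fin p) :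
    quadForm A (stdVec i) = A i i := by
  simp [quadForm, stdVec]

theorem quadForm_stdVec_add {p : ℕ} (A : Matrix (Fin p) (Fin p) ℝ) (i j : Fin p) (a : ℝ) :
    quadForm A (stdVec i + a • stdVec j) = A i i + a * (A i j + A j i) + a ^ 2 * A j j := by
  simp [quadForm, stdVec, add_mul, mul_add, Finset.sum_add_distrib]
  ring

theorem extVec_self {p : ℕ} (i : Fin p) : (extVec i i : Pt p) = stdVec i := if_pos rfl

theorem quadForm_extVec {p : ℕ} {A : Matrix (Fin p) (Fin p) ℝ} {i j : Fin p}
    (hA : A i j = A j i) (hij : i ≠ j) :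
    quadForm A (extVec i j) = (A i i + A j j) / 2 + A i j := by
  have h := quadForm_stdVec_add A i j 1
  rw [one_smul] at h
  rw [extVec, if_neg hij, quadForm_smul, h, div_pow, Real.sq_sqrt two_pos.le, ← hA]
  ring

theorem norm_extVec {p : ℕ} (i j : Fin p) : ‖(extVec i j : Pt p)‖ = 1 := by
  by_cases hij : i = j
  · subst hij
    rw [extVec_self, norm_stdVec]
  · rw [← sq_eq_sq₀ (norm_nonneg _) zero_le_one, ← quadForm_one, quadForm_extVec _ hij]
    · simp [Matrix.one_apply_ne hij]
    · rw [Matrix.one_apply_ne hij, Matrix.one_apply_ne (Ne.symm hij)]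

/-- Nonnegativity of the form at e_i - e_j gives 2 A_ij ≤ A_ii + A_jj. This bounds every ratio
searched for once the diagonal is bounded. -/
theorem Matrix.PosSemidef.quadForm_extVec_le {p : ℕ} {A : Matrix (Fin p) (Fin p) ℝ}
    (hA : A.PosSemidef) (i j : Fin p) : quadForm A (extVec i j) ≤ A i i + A j j := by
  by_cases hij : i = j
  · subst hij
    have := hA.diag_nonneg (i := i)
    rw [extVec_self, quadForm_stdVec]
    linarith
  · have hs : A i j = A j i := by simpa using hA.isHermitian.apply j i
    have h := hA.quadForm_nonneg (stdVec i + (-1 : ℝ) • stdVec j)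
    rw [quadForm_stdVec_add, ← hs] at h
    rw [quadForm_extVec hs hij]
    linarith

theorem length_extPairs_le (p : ℕ) : (extPairs p).length ≤ p ^ 2 := by
  refine (List.length_filter_le _ _).trans ?_
  rw [List.product, List.length_flatMap]
  simp [sq]

theorem mem_extPairs {p : ℕ} {q : Fin p × Fin p} : q ∈ extPairs p ↔ q.1 ≤ q.2 := by
  simp [extPairs, List.product]

/-- Diagonal entries are off by at most η, the others by η + η/2 + η/2 = 2η. The sum of squares is
at most (4p² - 3p) η² ≤ p⁴ η²; keeping the -3p is what makes p = 1 work. -/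
theorem norm_solveSym_sub_le {p : ℕ} {A : Matrix (Fin p) (Fin p) ℝ} {f : Fin p × Fin p → ℝ}
    {η : ℝ} (hη : 0 ≤ η) (hA : ∀ i j, A i j = A j i)
    (hf : ∀ i j, i ≤ j → |f (i, j) - quadForm A (extVec i j)| ≤ η) :
    ‖solveSym f - A‖ ≤ p ^ 2 * η := by
  have hdiag : ∀ i, |f (i, i) - A i i| ≤ η := fun i => by
    simpa only [extVec_self, quadForm_stdVec] using hf i i le_rfl
  have hoff : ∀ i j, i ≠ j → |f (min i j, max i j) - ((A i i + A j j) / 2 + A i j)| ≤ η := by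
    intro i j hij
    rcases lt_or_gt_of_ne hij with h | h
    · rw [min_eq_left h.le, max_eq_right h.le, ← quadForm_extVec (hA i j) hij]
      exact hf i j h.le
    · rw [min_eq_right h.le, max_eq_left h.le, add_comm (A i i), hA i j,
        ← quadForm_extVec (hA j i) hij.symm]
      exact hf j i h.le
  have hentry : ∀ i j, (solveSym f - A) i j ^ 2 ≤ 4 * η ^ 2 - if i = j then 3 * η ^ 2 else 0 := by
    intro i j
    by_cases hij : i = j
    · subst hij
      have h := sq_le_sq' (abs_le.1 (hdiag i)).1 (abs_le.1 (hdiag i)).2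
      simp only [solveSym, Matrix.sub_apply, Matrix.of_apply, if_true]
      linarith
    · have h0 := abs_le.1 (hoff i j hij)
      have h1 := abs_le.1 (hdiag i)
      have h2 := abs_le.1 (hdiag j)
      simp only [solveSym, Matrix.sub_apply, Matrix.of_apply, if_neg hij, sub_zero]
      have := sq_le_sq' (a := f (min i j, max i j) - (f (i, i) + f (j, j)) / 2 - A i j)
        (b := 2 * η) (by linarith) (by linarith)
      linarith
  refine le_of_sq_le_sq ?_ (by positivity)
  rw [sq_frobenius_norm]
  calc ∑ i, ∑ j, (solveSym f - A) i j ^ 2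
      ≤ ∑ i : Fin p, ∑ j : Fin p, (4 * η ^ 2 - if i = j then 3 * η ^ 2 else 0) :=
        Finset.sum_le_sum fun i _ => Finset.sum_le_sum fun j _ => hentry i j
    _ = (4 * (p : ℝ) ^ 2 - 3 * p) * η ^ 2 := by
        simp [Finset.sum_sub_distrib]
        ring
    _ ≤ (p : ℝ) ^ 4 * η ^ 2 := by
        refine mul_le_mul_of_nonneg_right ?_ (sq_nonneg η)
        rcases Nat.lt_or_ge p 2 with h | h
        · interval_cases p <;> norm_num
        · have : (2 : ℝ) ≤ p := by exact_mod_cast h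
          nlinarith [sq_nonneg ((p : ℝ) ^ 2), mul_le_mul this this (by norm_num) (by linarith)]
    _ = (p ^ 2 * η) ^ 2 := by ring

/-! ### Targets -/

section Target

variable {p : ℕ} {X : Set (Pt p)} {lo hi M L r δ Δ : ℝ} {d : Pt p → Pt p → ℝ}

theorem IsTarget.le_quadForm (h : IsTarget X lo hi M L r δ Δ d) {x : Pt p} (hx : x ∈ X)
    (v : Pt p) : lo * ‖v‖ ^ 2 ≤ quadForm (hess d x) v := by
  have := (h.eigenvalues x hx).2.quadForm_nonneg v
  rw [quadForm_sub, quadForm_smul_left, quadForm_one] at this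
  linarith

theorem IsTarget.quadForm_le (h : IsTarget X lo hi M L r δ Δ d) {x : Pt p} (hx : x ∈ X)
    (v : Pt p) : quadForm (hess d x) v ≤ hi * ‖v‖ ^ 2 := by
  have := (h.eigenvalues x hx).1.quadForm_nonneg v
  rw [quadForm_sub, quadForm_smul_left, quadForm_one] at this
  linarith

theorem IsTarget.posSemidef_hess (h : IsTarget X lo hi M L r δ Δ d) (hlo : 0 ≤ lo) {x : Pt p}
    (hx : x ∈ X) : (hess d x).PosSemidef := by
  have h1 := (h.eigenvalues x hx).2.add
    ((Matrix.PosSemidef.one : (1 : Matrix (Fin p) (Fin p) ℝ).PosSemidef).smul hlo)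
  rwa [sub_add_cancel] at h1

/-- With K = M p^(3/2), the two Taylor errors are at most Kρ³/6 and 8Kρ³/6, as √c ≤ 2. Dividing
their sum by ρ²/2 gives 3Kρ, and then by the form at y, which is at least `lo`, the stated error. -/
theorem IsTarget.comparesWith (h : IsTarget X lo hi M L r δ Δ d) (hlo : 0 < lo) (hM : 0 ≤ M)
    {x y u : Pt p} (hx : x ∈ X) {ρ : ℝ} (hρ : 0 < ρ) (hρr : 2 * ρ < r) (hy : ‖y‖ = 1)
    (hu : ‖u‖ = 1) :
    ComparesWith d x y u ρ (quadForm (hess d x) u / quadForm (hess d x) y)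
      (3 * M * (p : ℝ) ^ (3 / 2 : ℝ) * ρ / lo) := by
  intro c hc0 hc4
  set K : ℝ := M * (p : ℝ) ^ (3 / 2 : ℝ) with hK
  have hK0 : 0 ≤ K := by positivity
  have hc2 : √c ≤ 2 := Real.sqrt_le_iff.2 ⟨by norm_num, by linarith⟩
  have hnu : ‖ρ • u‖ = ρ := by rw [norm_smul, hu, Real.norm_of_nonneg hρ.le, mul_one]
  have hny : ‖(ρ * √c) • y‖ = ρ * √c := by
    rw [norm_smul, hy, Real.norm_of_nonneg (by positivity), mul_one]
  have hyr : ρ * √c ≤ 2 * ρ := by nlinarith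
  have h1 := h.smooth.abs_sub_le hM h.distance hx (v := ρ • u) (by linarith)
  have h2 := h.smooth.abs_sub_le hM h.distance hx (v := (ρ * √c) • y) (by linarith)
  rw [hnu, quadForm_smul, ← hK, abs_le] at h1
  rw [hny, quadForm_smul, ← hK, abs_le, mul_pow ρ _ 2, Real.sq_sqrt hc0] at h2
  have h3 : (ρ * √c) ^ 3 ≤ 8 * ρ ^ 3 := by
    calc (ρ * √c) ^ 3 ≤ (2 * ρ) ^ 3 := pow_le_pow_left₀ (by positivity) hyr 3
      _ = _ := by ring
  have h4 : K / 6 * (ρ * √c) ^ 3 ≤ K / 6 * (8 * ρ ^ 3) :=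
    mul_le_mul_of_nonneg_left h3 (by positivity)
  have hlo' : lo ≤ quadForm (hess d x) y := by
    have := h.le_quadForm hx y
    rwa [hy, one_pow, mul_one] at this
  have hpos : 0 < quadForm (hess d x) y := hlo.trans_le hlo'
  set a := quadForm (hess d x) u
  set b := quadForm (hess d x) y
  have hσ : 3 * K * ρ ≤ 3 * M * (p : ℝ) ^ (3 / 2 : ℝ) * ρ / lo * b := by
    rw [div_mul_eq_mul_div, le_div_iff₀ hlo, hK]
    calc 3 * (M * (p : ℝ) ^ (3 / 2 : ℝ)) * ρ * lo ≤ 3 * (M * (p : ℝ) ^ (3 / 2 : ℝ)) * ρ * b :=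
          mul_le_mul_of_nonneg_left hlo' (by positivity)
      _ = _ := by ring
  have hρ2 : 0 < ρ ^ 2 := by positivity
  constructor
  · intro hle
    have h5 : ρ ^ 2 * a ≤ ρ ^ 2 * (c * b + 3 * K * ρ) := by nlinarith
    have h6 := le_of_mul_le_mul_left h5 hρ2
    rw [div_le_iff₀ hpos]
    linarith
  · intro hle
    have h5 : ρ ^ 2 * (c * b) ≤ ρ ^ 2 * (a + 3 * K * ρ) := by nlinarith
    have h6 := le_of_mul_le_mul_left h5 hρ2
    rw [← sub_le_iff_le_add, le_div_iff₀ hpos]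
    linarith

theorem add_smul_mem_ball {x v : Pt p} {a : ℝ} (hv : ‖v‖ = 1) (ha : 0 ≤ a) (har : a < r) :
    x + a • v ∈ Metric.ball x r := by
  rw [mem_ball_iff_norm, add_sub_cancel_left, norm_smul, hv, Real.norm_of_nonneg ha, mul_one]
  exact har

/-- The properties of the learner of a Mahalanobis matrix at `x`. -/
structure MahalanobisSpec (r lo hi : ℝ) (d : Pt p → Pt p → ℝ) (x : Pt p) (ξ : ℝ) (n : ℕ)
    (A : Matrix (Fin p) (Fin p) ℝ) (asked : List (Pt p × Pt p × Pt p)) : Prop where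
  posSemidef : A.PosSemidef
  norm_sub_le : ∃ τ ∈ Set.Icc (1 / hi) (1 / lo), ‖τ • hess d x - A‖ ≤ ξ
  length : asked.length ≤ n
  mem_ball : ∀ q ∈ asked, q.1 = x ∧ q.2.1 ∈ Metric.ball x r ∧ q.2.2 ∈ Metric.ball x r

theorem IsTarget.mahalanobisSpec [NeZero p] (h : IsTarget X lo hi M L r δ Δ d) (hlo : 0 < lo)
    (hM : 0 ≤ M) {x : Pt p} (hx : x ∈ X) {ρ η : ℝ} (hρ : 0 < ρ) (hρr : 2 * ρ < r) (hη : 0 < η)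
    (hη1 : η ≤ 1) (hρη : 3 * M * (p : ℝ) ^ (3 / 2 : ℝ) * ρ / lo ≤ η / 2) {T k : ℕ}
    (hk : 2 ≤ η * 2 ^ k) (hT : k + 3 ≤ T) :
    MahalanobisSpec r lo hi d x (2 * (p ^ 2 * η)) (p ^ 2 * (k + 4))
      ((learnMahalanobis x ρ η T).run (tripletLabel d))
      ((learnMahalanobis x ρ η T).queries (tripletLabel d)) := by
  obtain ⟨b1, b2, b3⟩ := findMax_spec d x ρ 0 (List.finRange p)
  set b := (findMax x ρ 0 (List.finRange p)).run (tripletLabel d) with hb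
  set H := hess d x with hH
  set σ := 3 * M * (p : ℝ) ^ (3 / 2 : ℝ) * ρ / lo with hσ
  have hσ0 : 0 ≤ σ := by positivity
  have hHpsd : H.PosSemidef := h.posSemidef_hess hlo.le hx
  have hHb : lo ≤ H b b ∧ H b b ≤ hi := by
    have h1 := h.le_quadForm hx (stdVec b)
    have h2 := h.quadForm_le hx (stdVec b)
    rw [norm_stdVec, one_pow, mul_one, quadForm_stdVec] at h1 h2
    exact ⟨h1, h2⟩
  have hHb0 : 0 < H b b := hlo.trans_le hHb.1
  have hcmp : ∀ u : Pt p, ‖u‖ = 1 →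
      ComparesWith d x (stdVec b) u ρ (quadForm H u / H b b) σ := fun u hu => by
    have := h.comparesWith hlo hM hx hρ hρr (norm_stdVec b) hu
    rwa [quadForm_stdVec] at this
  -- The scan maximises d at scale ρ and not H_ii itself, hence the 1 + σ; the comparison used is
  -- the one with c = 1.
  have hdiag : ∀ i, H i i ≤ (1 + σ) * H b b := fun i => by
    have h1 := (hcmp (stdVec i) (norm_stdVec i) 1 zero_le_one (by norm_num)).1 (by
      rw [Real.sqrt_one, mul_one]
      exact b1 i (by simp))
    rwa [quadForm_stdVec, div_le_iff₀ hHb0] at h1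
  have hsearch : ∀ q ∈ extPairs p, SearchSpec d x (stdVec b) (extVec q.1 q.2) ρ η
      (quadForm H (extVec q.1 q.2) / H b b) (k + 3)
      (binarySearch x (stdVec b) (extVec q.1 q.2) ρ η T 0 none 1) := fun q _ => by
    have h0 : 0 ≤ quadForm H (extVec q.1 q.2) / H b b :=
      div_nonneg (hHpsd.quadForm_nonneg _) hHb0.le
    -- As σ ≤ η / 2 ≤ 1/2, this keeps the ratio plus σ below 4.
    have h2 : quadForm H (extVec q.1 q.2) / H b b ≤ 2 + 2 * σ := by
      rw [div_le_iff₀ hHb0]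
      linarith [hHpsd.quadForm_extVec_le q.1 q.2, hdiag q.1, hdiag q.2]
    exact searchSpec_binarySearch (hcmp _ (norm_extVec _ _)) hρη hη T k hT hk (by linarith)
      (by linarith)
  obtain ⟨c1, c2, c3⟩ := learnCoeffs_spec (extPairs p) hsearch
  simp only [learnMahalanobis, run_monad_bind, queries_monad_bind, run_pure, queries_pure,
    List.append_nil, ← hb]
  have hτ : ∀ q ∈ extPairs p, quadForm H (extVec q.1 q.2) / H b b =
      quadForm ((1 / H b b) • H) (extVec q.1 q.2) := fun q _ => by
    rw [quadForm_smul_left]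
    ring
  have hτpsd : ((1 / H b b) • H).PosSemidef := hHpsd.smul (by positivity)
  refine ⟨(psdProj_spec _).1, ⟨1 / H b b, ⟨one_div_le_one_div_of_le hHb0 hHb.2,
    one_div_le_one_div_of_le hlo hHb.1⟩, ?_⟩, ?_, ?_⟩
  · refine (norm_sub_psdProj_le _ hτpsd).trans ?_
    refine mul_le_mul_of_nonneg_left (norm_solveSym_sub_le hη.le (fun i j => ?_) ?_) two_pos.le
    · simpa using hτpsd.isHermitian.apply j i
    · intro i j hij
      have hm : (i, j) ∈ extPairs p := mem_extPairs.2 hij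
      rw [← hτ _ hm]
      exact c1 _ hm
  · rw [List.length_append, b2, List.length_finRange]
    -- The p queries of the scan are charged as one extra round per search: p + p² (k + 3) ≤ p² (k +
    -- 4).
    have h1 : p ≤ p ^ 2 := Nat.le_self_pow two_ne_zero p
    have h2 := Nat.mul_le_mul_right (k + 3) (length_extPairs_le p)
    linarith
  · intro q hq
    rcases List.mem_append.1 hq with hq | hq
    · obtain ⟨i, j, rfl⟩ := b3 q hq
      exact ⟨rfl, add_smul_mem_ball (norm_stdVec i) hρ.le (by linarith),
        add_smul_mem_ball (norm_stdVec j) hρ.le (by linarith)⟩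
    · obtain ⟨i, j, c, hc0, hc4, rfl⟩ := c3 q hq
      have hc2 : √c ≤ 2 := Real.sqrt_le_iff.2 ⟨by norm_num, by linarith⟩
      exact ⟨rfl, add_smul_mem_ball (norm_stdVec b) (by positivity) (by nlinarith),
        add_smul_mem_ball (norm_extVec i j) hρ.le (by linarith)⟩

theorem learnLocal_spec [NeZero p] {ρ η ξ : ℝ} {T n : ℕ} (l : List (Pt p))
    (h : ∀ x ∈ l, MahalanobisSpec r lo hi d x ξ n
      ((learnMahalanobis x ρ η T).run (tripletLabel d))
      ((learnMahalanobis x ρ η T).queries (tripletLabel d))) :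
    (∀ x ∈ l, ((learnLocal ρ η T l).run (tripletLabel d) x).PosSemidef ∧
      ∃ τ ∈ Set.Icc (1 / hi) (1 / lo),
        ‖τ • hess d x - (learnLocal ρ η T l).run (tripletLabel d) x‖ ≤ ξ) ∧
    ((learnLocal ρ η T l).queries (tripletLabel d)).length ≤ l.length * n ∧
    ∀ q ∈ (learnLocal ρ η T l).queries (tripletLabel d),
      q.1 ∈ l ∧ q.2.1 ∈ Metric.ball q.1 r ∧ q.2.2 ∈ Metric.ball q.1 r := by
  classical
  induction l with
  | nil => simp [learnLocal, queries_ret]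
  | cons a l ih =>
    obtain ⟨h1, h2, h3⟩ := ih fun x hx => h x (List.mem_cons_of_mem _ hx)
    obtain ⟨s1, s2, s3, s4⟩ := h a List.mem_cons_self
    simp only [learnLocal, run_monad_bind, queries_monad_bind, run_pure, queries_pure,
      List.append_nil, List.length_append, List.length_cons, List.mem_append]
    refine ⟨fun x hx => ?_, by linarith, ?_⟩
    · by_cases hxa : x = a
      · subst hxa
        simp only [Function.update_self]
        exact ⟨s1, s2⟩
      · simp only [Function.update_of_ne hxa]
        exact h1 x ((List.mem_cons.1 hx).resolve_left hxa)
    · rintro q (hq | hq)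
      · obtain ⟨e, h⟩ := s4 q hq
        rw [e]
        exact ⟨List.mem_cons_self, h⟩
      · exact ⟨List.mem_cons_of_mem _ (h3 q hq).1, (h3 q hq).2⟩

end Target

/-! ### The switched distance is triplet equivalent to the target -/

section Equivalence

variable {p : ℕ} {X : Set (Pt p)} {lo hi M L r δ δ₀ Δ : ℝ} {d : Pt p → Pt p → ℝ}

theorem IsTarget.le_of_lt_norm_sub (h : IsTarget X lo hi M L r δ Δ d) {x y : Pt p} (hx : x ∈ X)
    (hy : y ∈ X) (hxy : δ < ‖x - y‖) : Δ ≤ d x y := by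
  have h1 : separation X d δ ≤ ENNReal.ofReal (d x y) :=
    iInf₂_le_of_le x hx (iInf₂_le_of_le y hy (iInf_le _ hxy))
  exact (ENNReal.ofReal_le_ofReal_iff (h.distance.1 x hx y hy)).1 (h.separated.trans h1)

theorem IsTarget.lo_le_hi [NeZero p] (h : IsTarget X lo hi M L r δ Δ d) {x : Pt p} (hx : x ∈ X) :
    lo ≤ hi := by
  have h1 := (h.le_quadForm hx (stdVec 0)).trans (h.quadForm_le hx (stdVec 0))
  simpa [norm_stdVec] using h1

theorem IsTarget.abs_sub_quadForm_le (h : IsTarget X lo hi M L r δ Δ d) (hM : 0 ≤ M)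
    {x y : Pt p} (hx : x ∈ X) (hr : ‖x - y‖ < r) :
    |d x y - quadForm (hess d x) (y - x) / 2| ≤
      M * (p : ℝ) ^ (3 / 2 : ℝ) / 6 * ‖y - x‖ * ‖y - x‖ ^ 2 := by
  have h1 := h.smooth.abs_sub_le hM h.distance hx (v := y - x) (by rwa [norm_sub_rev])
  rw [add_sub_cancel] at h1
  exact h1.trans_eq (by ring)

/-- The radius δ₀ is the one at which the Taylor error is at most `lo` / 4 times ‖y - x‖², half of
the least quadratic term. -/
theorem IsTarget.bounds_of_near (h : IsTarget X lo hi M L r δ Δ d) (hM : 0 ≤ M)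
    (hδ₀ : M * (p : ℝ) ^ (3 / 2 : ℝ) * δ₀ ≤ 3 / 2 * lo) (hlh : lo ≤ hi) {x y : Pt p} (hx : x ∈ X)
    (hr : ‖x - y‖ < r) (hxy : ‖y - x‖ ≤ δ₀) :
    lo / 4 * ‖y - x‖ ^ 2 ≤ d x y ∧ d x y ≤ 3 / 4 * hi * ‖y - x‖ ^ 2 := by
  have h1 := abs_le.1 (h.abs_sub_quadForm_le hM hx hr)
  have h2 := h.le_quadForm hx (y - x)
  have h3 := h.quadForm_le hx (y - x)
  have hs : 0 ≤ ‖y - x‖ ^ 2 := sq_nonneg _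
  have h4 : M * (p : ℝ) ^ (3 / 2 : ℝ) / 6 * ‖y - x‖ * ‖y - x‖ ^ 2 ≤ lo / 4 * ‖y - x‖ ^ 2 := by
    refine mul_le_mul_of_nonneg_right ?_ hs
    have h5 : M * (p : ℝ) ^ (3 / 2 : ℝ) * ‖y - x‖ ≤ M * (p : ℝ) ^ (3 / 2 : ℝ) * δ₀ :=
      mul_le_mul_of_nonneg_left hxy (by positivity)
    linarith
  have h5 : lo * ‖y - x‖ ^ 2 ≤ hi * ‖y - x‖ ^ 2 := mul_le_mul_of_nonneg_right hlh hs
  constructor <;> linarith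

/-- A matrix that is close to a multiple of the Hessian at a nearby point. -/
theorem IsTarget.abs_quadForm_sub_le (h : IsTarget X lo hi M L r δ Δ d) (hlo : 0 < lo)
    (hhi : 0 < hi) (hL : 0 ≤ L) {x a : Pt p} (hx : x ∈ X) (ha : a ∈ X)
    {A : Matrix (Fin p) (Fin p) ℝ} {τ ξ ε m : ℝ} (hm : 0 ≤ m) (hτ : 1 / hi ≤ τ)
    (hA : ‖τ • hess d a - A‖ ≤ ξ) (hxa : ‖x - a‖ ≤ ε) (hξ : ξ ≤ m * lo / 24 * (1 / hi))
    (hε : L * ε ≤ m * lo / 24) (v : Pt p) :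
    |quadForm A v - τ * quadForm (hess d x) v| ≤ τ * (m * lo / 12) * ‖v‖ ^ 2 := by
  have hτ0 : 0 ≤ τ := le_trans (by positivity) hτ
  have hs : 0 ≤ ‖v‖ ^ 2 := sq_nonneg _
  have h1 := abs_le.1 (abs_quadForm_le (τ • hess d a - A) v)
  have h2 := abs_le.1 (abs_quadForm_le (hess d x - hess d a) v)
  rw [quadForm_sub, quadForm_smul_left] at h1
  rw [quadForm_sub] at h2
  -- The bound on ξ carries 1 / `hi` ≤ τ, so that the error is relative to τ. Moving the Hessian
  -- from a to x costs as much again.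
  have h3 : ‖τ • hess d a - A‖ * ‖v‖ ^ 2 ≤ m * lo / 24 * τ * ‖v‖ ^ 2 :=
    mul_le_mul_of_nonneg_right ((hA.trans hξ).trans
      (mul_le_mul_of_nonneg_left hτ (by positivity))) hs
  have h4 : ‖hess d x - hess d a‖ * ‖v‖ ^ 2 ≤ m * lo / 24 * ‖v‖ ^ 2 :=
    mul_le_mul_of_nonneg_right ((h.hessian x hx a ha).trans
      ((mul_le_mul_of_nonneg_left hxa hL).trans hε)) hs
  have h5 := mul_le_mul_of_nonneg_left (h2.1.trans' (neg_le_neg h4)) hτ0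
  have h6 := mul_le_mul_of_nonneg_left (h2.2.trans h4) hτ0
  rw [abs_le]
  constructor <;> linarith

/-- The bounds on a quadratic form that is close to a multiple of the Hessian. -/
theorem IsTarget.quadForm_bounds (h : IsTarget X lo hi M L r δ Δ d) (hlo : 0 < lo) (hhi : 0 < hi)
    (hlh : lo ≤ hi) {x v : Pt p} (hx : x ∈ X) {q τ m : ℝ} (hm1 : m ≤ 1) (hτ : 1 / hi ≤ τ)
    (hτ' : τ ≤ 1 / lo)
    (hq : |q - τ * quadForm (hess d x) v| ≤ τ * (m * lo / 12) * ‖v‖ ^ 2) :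
    lo / (2 * hi) * ‖v‖ ^ 2 ≤ q ∧ q ≤ 2 * hi / lo * ‖v‖ ^ 2 := by
  have hτ0 : 0 < τ := lt_of_lt_of_le (by positivity) hτ
  have hτhi : 1 ≤ τ * hi := by rwa [div_le_iff₀ hhi] at hτ
  have hτlo : τ * lo ≤ 1 := by rwa [le_div_iff₀ hlo] at hτ'
  have hmlo : m * lo ≤ lo := mul_le_of_le_one_left hlo.le hm1
  have hs : 0 ≤ ‖v‖ ^ 2 := sq_nonneg _
  have h1 := abs_le.1 hq
  have h2 := mul_le_mul_of_nonneg_left (h.le_quadForm hx v) hτ0.le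
  have h3 := mul_le_mul_of_nonneg_left (h.quadForm_le hx v) hτ0.le
  have h4 : τ * (m * lo / 12) * ‖v‖ ^ 2 ≤ τ * (lo / 12) * ‖v‖ ^ 2 := by gcongr
  have h5 : τ * lo * ‖v‖ ^ 2 ≤ τ * hi * ‖v‖ ^ 2 := by gcongr
  have h6 : lo / (2 * hi) ≤ τ * lo / 2 := by
    rw [div_le_iff₀ (by positivity)]
    linarith only [mul_le_mul_of_nonneg_left hτhi hlo.le]
  have h7 : 2 * (τ * hi) ≤ 2 * hi / lo := by
    rw [le_div_iff₀ hlo]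
    linarith only [mul_le_mul_of_nonneg_left hτlo hhi.le]
  have h8 := mul_le_mul_of_nonneg_right h6 hs
  have h9 := mul_le_mul_of_nonneg_right h7 hs
  have h10 : 0 ≤ τ * lo * ‖v‖ ^ 2 := by positivity
  constructor
  · linarith only [h1.1, h2, h4, h8, h10]
  · linarith only [h1.2, h3, h4, h5, h9, h10]

/-- A quadratic form that is close to a multiple `τ` of the Hessian is close to `2 τ d` at short
distances. -/
theorem IsTarget.quadForm_approx (h : IsTarget X lo hi M L r δ Δ d) (hM : 0 ≤ M)
    (hδ₀ : M * (p : ℝ) ^ (3 / 2 : ℝ) * δ₀ ≤ 3 / 2 * lo) (hlh : lo ≤ hi) {x y : Pt p} (hx : x ∈ X)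
    (hr : ‖x - y‖ < r) {q τ m R : ℝ} (hm : 0 ≤ m) (hτ : 0 ≤ τ)
    (hR : M * (p : ℝ) ^ (3 / 2 : ℝ) * R ≤ m * lo / 8) (hRδ : R ≤ δ₀) (hxy : ‖y - x‖ ≤ R)
    (hq : |q - τ * quadForm (hess d x) (y - x)| ≤ τ * (m * lo / 12) * ‖y - x‖ ^ 2) :
    (1 - m / 4) * (2 * τ * d x y) ≤ q ∧ q ≤ (1 + m / 4) * (2 * τ * d x y) := by
  have hs : 0 ≤ ‖y - x‖ ^ 2 := sq_nonneg _
  have h1 := abs_le.1 hq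
  have h2 := abs_le.1 (h.abs_sub_quadForm_le hM hx hr)
  have h3 : M * (p : ℝ) ^ (3 / 2 : ℝ) / 6 * ‖y - x‖ * ‖y - x‖ ^ 2 ≤
      m * lo / 48 * ‖y - x‖ ^ 2 := by
    refine mul_le_mul_of_nonneg_right ?_ hs
    have : M * (p : ℝ) ^ (3 / 2 : ℝ) * ‖y - x‖ ≤ M * (p : ℝ) ^ (3 / 2 : ℝ) * R :=
      mul_le_mul_of_nonneg_left hxy (by positivity)
    linarith only [this, hR]
  have h4 := mul_le_mul_of_nonneg_left (h2.1.trans' (neg_le_neg h3)) hτ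
  have h5 := mul_le_mul_of_nonneg_left (h2.2.trans h3) hτ
  -- The errors add up to τ m lo (1/12 + 2/48) = τ m lo / 8 times ‖y - x‖². This is (m/4)(2τ) times
  -- the lower bound (lo/4) ‖y - x‖² for d.
  have h6 := mul_le_mul_of_nonneg_left (h.bounds_of_near hM hδ₀ hlh hx hr (hxy.trans hRδ)).1
    (show 0 ≤ τ * m / 2 by positivity)
  constructor
  · linarith only [h1.1, h5, h6]
  · linarith only [h1.2, h4, h6]

/-- It shows that two points with the same nearest centre, being within 2ε of each other, stay on
the local branch. -/
theorem sq_le_of_gap {ω θ ε : ℝ} (hlo : 0 < lo) (hlh : lo ≤ hi) (hω : 0 < ω) (hθ : 0 ≤ θ)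
    (hgap : 3 * hi * ε ^ 2 * (1 + ω) ≤ ω * (lo ^ 2 / (8 * hi) * θ)) :
    8 * hi / lo * ε ^ 2 ≤ θ := by
  have hhi : 0 < hi := hlo.trans_le hlh
  have h0 : 0 ≤ 3 * hi * ε ^ 2 := by positivity
  have h2 : 3 * hi * ε ^ 2 ≤ lo ^ 2 / (8 * hi) * θ :=
    le_of_mul_le_mul_left (by linarith only [hgap, h0]) hω
  have h3 : lo ^ 2 / (8 * hi) * θ ≤ lo / 8 * θ := by
    refine mul_le_mul_of_nonneg_right ?_ hθ
    rw [div_le_iff₀ (by positivity)]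
    linarith only [mul_le_mul_of_nonneg_left hlh hlo.le]
  have h4 : 0 ≤ lo * θ := by positivity
  rw [div_mul_eq_mul_div, div_le_iff₀ hlo]
  linarith only [h2, h3, h4]

/-- Four cases, by the branches of y and z. Two local points are ordered by `hmω`; `hθR` and `hθΔ`
rule out y local with z global; `hgap` handles two global points and separates the centres when only
y is global. -/
theorem multTripletEquiv_switchDist [NeZero p] {𝒞 : Finset (Pt p)} {c : Pt p → Pt p}
    {f : Pt p → Pt p → ℝ} {A : Pt p → Matrix (Fin p) (Fin p) ℝ} {ω m θ ε ξ R : ℝ}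
    (h : IsTarget X lo hi M L r δ Δ d) (hlo : 0 < lo) (hhi : 0 < hi) (hM : 0 < M) (hL : 0 ≤ L)
    (hω : 0 < ω) (hm : 0 < m) (hm1 : m ≤ 1) (hmω : 1 + m / 4 ≤ (1 - m / 4) * (1 + ω))
    (hδ : δ ≤ δ₀) (hδ₀ : M * (p : ℝ) ^ (3 / 2 : ℝ) * δ₀ ≤ 3 / 2 * lo)
    (hr : ∀ x ∈ X, ∀ y ∈ X, ‖x - y‖ ≤ δ₀ → ‖x - y‖ < r)
    (hR0 : 0 < R) (hR : M * (p : ℝ) ^ (3 / 2 : ℝ) * R ≤ m * lo / 8) (hRδ : R ≤ δ₀)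
    (hξ : ξ ≤ m * lo / 24 * (1 / hi)) (hεL : L * ε ≤ m * lo / 24) (hεδ : ε ≤ δ₀) (hθ : 0 < θ)
    (hθR : 3 / 2 * hi ^ 2 / lo * θ ≤ lo / 4 * R ^ 2) (hθΔ : 3 / 2 * hi ^ 2 / lo * θ ≤ Δ)
    (hgap : 3 * hi * ε ^ 2 * (1 + ω) ≤ ω * (lo ^ 2 / (8 * hi) * θ))
    (h𝒞 : (𝒞 : Set (Pt p)) ⊆ X) (hc : ∀ x ∈ X, c x ∈ 𝒞) (hcε : ∀ x ∈ X, ‖x - c x‖ ≤ ε)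
    (hf : ∀ x ∈ 𝒞, RanksFrom 𝒞.toList d f x)
    (hA : ∀ a ∈ 𝒞, ∃ τ ∈ Set.Icc (1 / hi) (1 / lo), ‖τ • hess d a - A a‖ ≤ ξ) :
    MultTripletEquiv X ω d (switchDist θ c f A) := by
  intro x hx y hy z hz hlt
  have hlh : lo ≤ hi := h.lo_le_hi hx
  have hdz : 0 ≤ d x z := h.distance.1 x hx z hz
  have hdlt : d x z < d x y := by nlinarith
  suffices hs : switchDist θ c f A x z < switchDist θ c f A x y by
    rw [tripletLabel_eq_pos_iff.2 hdlt, tripletLabel_eq_pos_iff.2 hs]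
  have hcx := hc x hx
  have hcxX : c x ∈ X := h𝒞 hcx
  obtain ⟨τ, ⟨hτ, hτ'⟩, hAτ⟩ := hA _ hcx
  have hτ0 : 0 < τ := lt_of_lt_of_le (by positivity) hτ
  have hq : ∀ w, |quadForm (A (c x)) (w - x) - τ * quadForm (hess d x) (w - x)| ≤
      τ * (m * lo / 12) * ‖w - x‖ ^ 2 := fun w =>
    h.abs_quadForm_sub_le hlo hhi hL hx hcxX hm.le hτ hAτ (hcε x hx) hξ hεL _
  have hqlo : ∀ w, lo / (2 * hi) * ‖w - x‖ ^ 2 ≤ quadForm (A (c x)) (w - x) := fun w =>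
    (h.quadForm_bounds hlo hhi hlh hx hm1 hτ hτ' (hq w)).1
  have hqhi : ∀ w, quadForm (A (c x)) (w - x) ≤ 2 * hi / lo * ‖w - x‖ ^ 2 := fun w =>
    (h.quadForm_bounds hlo hhi hlh hx hm1 hτ hτ' (hq w)).2
  have hnear : ∀ u ∈ X, ∀ w ∈ X, ‖w - u‖ ≤ δ₀ →
      lo / 4 * ‖w - u‖ ^ 2 ≤ d u w ∧ d u w ≤ 3 / 4 * hi * ‖w - u‖ ^ 2 := fun u hu w hw hle =>
    h.bounds_of_near hM.le hδ₀ hlh hu (hr u hu w hw (by rwa [norm_sub_rev])) hle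
  have hfar : ∀ w ∈ X, δ₀ < ‖w - x‖ → Δ ≤ d x w := fun w hw hle =>
    h.le_of_lt_norm_sub hx hw (by rw [norm_sub_rev]; exact hδ.trans_lt hle)
  have hacc : ∀ w ∈ X, ‖w - x‖ ≤ R →
      (1 - m / 4) * (2 * τ * d x w) ≤ quadForm (A (c x)) (w - x) ∧
      quadForm (A (c x)) (w - x) ≤ (1 + m / 4) * (2 * τ * d x w) := fun w hw hle =>
    h.quadForm_approx hM.le hδ₀ hlh hx
      (hr x hx w hw (by rw [norm_sub_rev]; exact hle.trans hRδ)) hm.le hτ0.le hR hRδ hle (hq w)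
  have hlocal : ∀ w, quadForm (A (c x)) (w - x) ≤ θ → ‖w - x‖ ^ 2 ≤ 2 * hi / lo * θ :=
    fun w hw => by
      have h1 := (hqlo w).trans hw
      have h2 := mul_le_mul_of_nonneg_left h1 (show 0 ≤ 2 * hi / lo by positivity)
      have e : 2 * hi / lo * (lo / (2 * hi) * ‖w - x‖ ^ 2) = ‖w - x‖ ^ 2 := by field_simp
      rwa [e] at h2
  have hlocalR : ∀ w, quadForm (A (c x)) (w - x) ≤ θ → ‖w - x‖ ≤ R := fun w hw => by
    refine le_of_sq_le_sq ((hlocal w hw).trans ?_) hR0.le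
    have e : 3 / 2 * hi ^ 2 / lo * θ = 3 / 4 * hi * (2 * hi / lo * θ) := by ring
    rw [e] at hθR
    have h1 : lo / 4 * R ^ 2 ≤ 3 / 4 * hi * R ^ 2 := by
      refine mul_le_mul_of_nonneg_right ?_ (sq_nonneg R)
      linarith only [hlh, hlo]
    exact le_of_mul_le_mul_left (hθR.trans h1) (by positivity)
  have hmono : ‖y - x‖ ≤ R → ‖z - x‖ ≤ R →
      quadForm (A (c x)) (z - x) < quadForm (A (c x)) (y - x) := fun hyR hzR => by
    have h1 := (hacc y hy hyR).1
    have h2 := (hacc z hz hzR).2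
    have h3 : (1 - m / 4) * (2 * τ * ((1 + ω) * d x z)) < (1 - m / 4) * (2 * τ * d x y) :=
      mul_lt_mul_of_pos_left (mul_lt_mul_of_pos_left hlt (by positivity)) (by linarith)
    have h4 := mul_le_mul_of_nonneg_right hmω (show 0 ≤ 2 * τ * d x z by positivity)
    linarith only [h1, h2, h3, h4]
  have hclose : ∀ u ∈ X, ∀ w ∈ X, ‖w - u‖ ≤ ε → d u w ≤ 3 / 4 * hi * ε ^ 2 :=
    fun u hu w hw hle => by
      refine (hnear u hu w hw (hle.trans hεδ)).2.trans ?_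
      gcongr
  have hε2 : 8 * hi / lo * ε ^ 2 ≤ θ := sq_le_of_gap hlo hlh hω hθ.le hgap
  have hcard : ∀ w ∈ X, c w ∈ 𝒞.toList := fun w hw => Finset.mem_toList.2 (hc w hw)
  have hRanks := hf _ hcx
  simp only [switchDist]
  by_cases hyθ : θ < quadForm (A (c x)) (y - x) <;> by_cases hzθ : θ < quadForm (A (c x)) (z - x)
  · rw [if_pos hyθ, if_pos hzθ]
    -- Within δ₀ a form above θ forces a long vector, hence a large d; beyond δ₀ the separation Δ
    -- suffices.
    have hdy : lo ^ 2 / (8 * hi) * θ ≤ d x y := by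
      rcases le_or_gt ‖y - x‖ δ₀ with hle | hgt
      · refine le_trans ?_ (hnear x hx y hy hle).1
        have h1 := mul_le_mul_of_nonneg_left (hyθ.le.trans (hqhi y))
          (show 0 ≤ lo ^ 2 / (8 * hi) by positivity)
        refine h1.trans_eq ?_
        field_simp
        ring
      · refine le_trans ?_ (hθΔ.trans (hfar y hy hgt))
        refine mul_le_mul_of_nonneg_right ?_ hθ.le
        rw [div_le_div_iff₀ (by positivity) hlo]
        have h1 : lo ^ 3 ≤ hi ^ 3 := pow_le_pow_left₀ hlo.le hlh 3
        have h2 : 0 < hi ^ 3 := by positivity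
        linarith only [h1, h2]
    -- The distance is directed, so d(x, c x) and d(c x, x) are bounded separately. Each of the four
    -- legs costs at most (3/4) hi ε², in total the 3 hi ε² of `hgap`.
    have h1 := h.triangle x hx (c x) hcxX y hy
    have h2 := h.triangle (c x) hcxX (c y) (h𝒞 (hc y hy)) y hy
    have h3 := h.triangle (c x) hcxX x hx (c z) (h𝒞 (hc z hz))
    have h4 := h.triangle x hx z hz (c z) (h𝒞 (hc z hz))
    have h5 := hclose x hx (c x) hcxX (by rw [norm_sub_rev]; exact hcε x hx)
    have h6 := hclose (c y) (h𝒞 (hc y hy)) y hy (hcε y hy)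
    have h7 := hclose (c x) hcxX x hx (hcε x hx)
    have h8 := hclose z hz (c z) (h𝒞 (hc z hz)) (by rw [norm_sub_rev]; exact hcε z hz)
    -- The hypothesis on the ratio amounts to ω d(x,y) < (1 + ω)(d(x,y) - d(x,z)).
    have h9 : 3 * hi * ε ^ 2 * (1 + ω) < (d x y - d x z) * (1 + ω) := by
      have := mul_le_mul_of_nonneg_left hdy hω.le
      linarith only [this, hgap, hlt]
    have h10 := lt_of_mul_lt_mul_right h9 (by positivity)
    have hcc : d (c x) (c z) < d (c x) (c y) := by
      linarith only [h1, h2, h3, h4, h5, h6, h7, h8, h10]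
    have hcy : c y ≠ c x := by
      intro e
      rw [e, h.distance.2 _ hcxX] at hcc
      exact hcc.not_ge (h.distance.1 _ hcxX _ (h𝒞 (hc z hz)))
    gcongr
    by_cases hcz : c z = c x
    · rw [hcz, hRanks.self]
      exact one_pos.trans_le (hRanks.one_le _ hcy)
    · exact hRanks.lt _ (hcard y hy) _ (hcard z hz) hcy hcz hcc
  · rw [if_pos hyθ, if_neg hzθ]
    -- Only a centre other than c x has rank at least 1, which lifts d'(x,y) strictly above θ.
    have hcy : c y ≠ c x := by
      intro e
      have h1 : ‖y - x‖ ≤ 2 * ε := by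
        calc ‖y - x‖ = ‖(y - c y) - (x - c x)‖ := by rw [e]; congr 1; abel
          _ ≤ ‖y - c y‖ + ‖x - c x‖ := norm_sub_le _ _
          _ ≤ 2 * ε := by linarith only [hcε x hx, hcε y hy]
      have h2 : quadForm (A (c x)) (y - x) ≤ 2 * hi / lo * (2 * ε) ^ 2 := by
        refine (hqhi y).trans ?_
        gcongr
      have h3 : 2 * hi / lo * (2 * ε) ^ 2 = 8 * hi / lo * ε ^ 2 := by ring
      linarith only [h2, h3, hε2, hyθ]
    have := hRanks.one_le _ hcy
    linarith only [this, not_lt.1 hzθ]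
  -- Within R the form would already be smaller at z than at y. Beyond R, d(x,z) is at least (lo/4)
  -- R² or Δ, both at least the bound on d(x,y) at a local y.
  · exfalso
    have hyR := hlocalR y (not_lt.1 hyθ)
    by_cases hzR : ‖z - x‖ ≤ R
    · have := hmono hyR hzR
      linarith only [this, not_lt.1 hyθ, hzθ]
    · have h1 : d x y ≤ 3 / 2 * hi ^ 2 / lo * θ := by
        refine (hnear x hx y hy (hyR.trans hRδ)).2.trans ?_
        have := mul_le_mul_of_nonneg_left (hlocal y (not_lt.1 hyθ))
          (show 0 ≤ 3 / 4 * hi by positivity)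
        refine this.trans_eq ?_
        ring
      rcases le_or_gt ‖z - x‖ δ₀ with hle | hgt
      · have h2 := (hnear x hx z hz hle).1
        have h3 : lo / 4 * R ^ 2 ≤ lo / 4 * ‖z - x‖ ^ 2 := by
          have := (not_le.1 hzR).le
          gcongr
        linarith only [h1, h2, h3, hθR, hdlt]
      · have := hfar z hz hgt
        linarith only [this, h1, hθΔ, hdlt]
  · rw [if_neg hyθ, if_neg hzθ]
    exact hmono (hlocalR y (not_lt.1 hyθ)) (hlocalR z (not_lt.1 hzθ))

end Equivalence

/-! ### The rates -/

theorem rate₂_one_pos {ω : ℝ} (hω : 0 < ω) : 0 < rate₂ 1 ω := by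
  rw [rate₂]
  split_ifs <;> positivity

theorem rate₂_one_le (ω : ℝ) : rate₂ 1 ω ≤ 1 := by
  rw [rate₂]
  split_ifs with h
  exacts [h.le, le_rfl]

theorem one_add_rate₂_le {ω : ℝ} (hω : 0 < ω) :
    1 + rate₂ 1 ω / 4 ≤ (1 - rate₂ 1 ω / 4) * (1 + ω) := by
  rw [rate₂]
  split_ifs with h <;> nlinarith

theorem rate₁_one_pos {ω : ℝ} (hω : 0 < ω) : 0 < rate₁ 1 ω := by
  rw [rate₁]
  split_ifs <;> positivity

theorem rate₁_one_sq {ω : ℝ} (hω : 0 < ω) :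
    rate₁ 1 ω ^ 2 = if ω < 1 then ω ^ 3 else 1 / ω := by
  rw [rate₁]
  split_ifs
  · rw [← Real.rpow_natCast, ← Real.rpow_mul hω.le, ← Real.rpow_natCast]
    norm_num
  · rw [div_pow, Real.sq_sqrt hω.le, one_pow]

theorem rate₁_one_le_rate₂ {ω : ℝ} (hω : 0 < ω) : rate₁ 1 ω ≤ rate₂ 1 ω := by
  refine le_of_sq_le_sq ?_ (rate₂_one_pos hω).le
  rw [rate₁_one_sq hω, rate₂]
  split_ifs with h
  · exact pow_le_pow_of_le_one hω.le h.le (by norm_num)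
  · rw [one_pow, div_le_one hω]
    exact not_lt.1 h

theorem rate₃_one_pos {ω : ℝ} (hω : 0 < ω) : 0 < rate₃ 1 ω := by
  rw [rate₃]
  split_ifs <;> positivity

theorem rate₃_one_le {ω : ℝ} (hω : 0 < ω) : rate₃ 1 ω ≤ rate₂ 1 ω ^ 2 := by
  rw [rate₃, rate₂]
  split_ifs with h
  · exact le_rfl
  · rw [one_pow, div_le_one hω]
    exact not_lt.1 h

/-- For ω < 1 this is ω³ (1 + ω) ≤ 2 ω³, and otherwise 1/ω + 1 ≤ 2. It makes ε² small against ωθ /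
(1 + ω). -/
theorem rate₁_one_sq_mul_le {ω : ℝ} (hω : 0 < ω) :
    rate₁ 1 ω ^ 2 * (1 + ω) ≤ 2 * ω * rate₃ 1 ω := by
  rw [rate₁_one_sq hω, rate₃]
  split_ifs with h
  · have h3 : 0 < ω ^ 3 := by positivity
    nlinarith
  · rw [div_mul_eq_mul_div, div_le_iff₀ hω]
    field_simp
    linarith [not_lt.1 h]

/-! ### The algorithm -/

theorem exists_isMinimalCover {p : ℕ} {X : Set (Pt p)} (hX : IsCompact X) {ε : ℝ≥0}
    (hε : 0 < ε) : ∃ 𝒞 : Finset (Pt p), IsMinimalCover ε X 𝒞 := by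
  obtain ⟨N, hNX, hN, hcov⟩ := Metric.exists_finite_isCover_of_isCompact hε.ne' hX
  have hne : Metric.coveringNumber ε X ≠ ⊤ :=
    ((hcov.coveringNumber_le_encard hNX).trans_lt hN.encard_lt_top).ne
  obtain ⟨C, hCX, hC, hCcov, hcard⟩ := Metric.exists_set_encard_eq_coveringNumber hne
  refine ⟨hC.toFinset, by rwa [hC.coe_toFinset], by rwa [hC.coe_toFinset], ?_⟩
  rw [← hcard, ← Set.encard_coe_eq_coe_finsetCard, hC.coe_toFinset]

theorem IsMinimalCover.norm_sub_nearest_le {p : ℕ} {X : Set (Pt p)} {ε : ℝ≥0}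
    {𝒞 : Finset (Pt p)} (h : IsMinimalCover ε X 𝒞) {c : Pt p → Pt p} (hc : IsNearest X 𝒞 c)
    {x : Pt p} (hx : x ∈ X) : ‖x - c x‖ ≤ ε := by
  obtain ⟨a, ha, hxa⟩ := h.2.1 hx
  have h1 : edist x a ≤ ε := hxa
  rw [edist_nndist, ENNReal.coe_le_coe, ← NNReal.coe_le_coe, coe_nndist, dist_eq_norm] at h1
  exact ((hc x hx).2 a ha).trans h1

theorem rpow_three_halves_sq (p : ℕ) : ((p : ℝ) ^ (3 / 2 : ℝ)) ^ 2 = (p : ℝ) ^ 3 := by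
  rw [← Real.rpow_natCast, ← Real.rpow_mul (by positivity), ← Real.rpow_natCast]
  norm_num

theorem smoothLearner_run {p : ℕ} [NeZero p] (𝒞 : Finset (Pt p)) (ρ ξ : ℝ) (T : ℕ)
    (ℓ : Pt p → Pt p → Pt p → SignType) :
    (smoothLearner 𝒞 ρ ξ T).run ℓ = ((learnFinite 𝒞.toList 𝒞.toList).run ℓ,
      (learnLocal ρ (ξ / (2 * (p : ℝ) ^ 2)) T 𝒞.toList).run ℓ) := by
  simp only [smoothLearner, run_monad_bind, run_pure]

theorem smoothLearner_queries {p : ℕ} [NeZero p] (𝒞 : Finset (Pt p)) (ρ ξ : ℝ) (T : ℕ)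
    (ℓ : Pt p → Pt p → Pt p → SignType) :
    (smoothLearner 𝒞 ρ ξ T).queries ℓ = (learnFinite 𝒞.toList 𝒞.toList).queries ℓ ++
      (learnLocal ρ (ξ / (2 * (p : ℝ) ^ 2)) T 𝒞.toList).queries ℓ := by
  simp only [smoothLearner, queries_monad_bind, queries_pure, List.append_nil]

/-- Since k + 4 ≤ log₂(1/η) + 6 = log₂(64/η), the condition ϑ ≤ η / 64 absorbs all additive
constants. -/
theorem length_queries_le {n p N k : ℕ} {a b η ϑ : ℝ} (hn : (n : ℝ) ≤ a + b)
    (ha : a ≤ N * (N * Real.logb 2 N)) (hb : b ≤ N * (p ^ 2 * (k + 4)))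
    (hk : (k : ℝ) ≤ Real.logb 2 (1 / η) + 2) (hη : 0 < η) (hϑ : 0 < ϑ) (hϑη : ϑ ≤ η / 64) :
    (n : ℝ) ≤ (N : ℝ) ^ 2 * Real.logb 2 N + N * (p : ℝ) ^ 2 * Real.logb 2 (1 / ϑ) := by
  have h1 : Real.logb 2 (1 / η) + 6 ≤ Real.logb 2 (1 / ϑ) := by
    have h2 : Real.logb 2 (1 / η) + 6 = Real.logb 2 (1 / (η / 64)) := by
      have e : (1 : ℝ) / (η / 64) = 1 / η * 2 ^ (6 : ℝ) := by
        rw [show (6 : ℝ) = (6 : ℕ) by norm_num, Real.rpow_natCast]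
        field_simp
        norm_num
      rw [e, Real.logb_mul (by positivity) (by positivity),
        Real.logb_rpow two_pos (by norm_num)]
    rw [h2]
    exact Real.logb_le_logb_of_le one_lt_two (by positivity)
      (one_div_le_one_div_of_le hϑ hϑη)
  have h3 : (N : ℝ) * (p ^ 2 * (k + 4)) ≤ N * (p ^ 2 * Real.logb 2 (1 / ϑ)) := by
    gcongr
    linarith
  linarith

/-- Choosing ρ₀ and T₀ before the target expresses that the scale does not depend on d and that the
searches terminate: all caps from T₀ on give the same guarantees. -/
theorem theorem5 (lo hi M L Δ : ℝ) (hlo : 0 < lo) (hhi : 0 < hi) (hM : 0 < M) (hL : 0 < L)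
    (hΔ : 0 < Δ) :
    ∃ D C C' C'' C₁ C₂ C₃ C₄ : ℝ,
      0 < D ∧ 0 < C ∧ 0 < C' ∧ 0 < C'' ∧ 0 < C₁ ∧ 0 < C₂ ∧ 0 < C₃ ∧ 0 < C₄ ∧
      ∀ (p : ℕ) [NeZero p] (ω : ℝ), 0 < ω →
      ∃ θ : ℝ, 0 < θ ∧ θ ≤ 4 * C' * rate₃ C₃ ω / (p : ℝ) ^ 3 ∧
      ∀ X : Set (Pt p), IsCompact X →
      ∀ δ : ℝ, 0 < δ → δ ≤ 3 * lo / (2 * M * (p : ℝ) ^ (3 / 2 : ℝ)) →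
      ∀ r : ℝ, 0 < r →
        (∀ x ∈ X, ∀ y ∈ X, ‖x - y‖ ≤ 3 * lo / (2 * M * (p : ℝ) ^ (3 / 2 : ℝ)) → ‖x - y‖ < r) →
      ∀ ε : ℝ≥0, 0 < ε → (ε : ℝ) ≤ C * rate₁ C₁ ω / (p : ℝ) ^ (3 / 2 : ℝ) →
      ∀ ξ : ℝ, 0 < ξ → ξ ≤ D * rate₂ C₂ ω →
      (∃ 𝒞 : Finset (Pt p), IsMinimalCover ε X 𝒞) ∧
      ∃ ρ₀ : ℝ, 0 < ρ₀ ∧ ∃ T₀ : ℕ, ∀ ρ : ℝ, 0 < ρ → ρ ≤ ρ₀ → ∀ T : ℕ, T₀ ≤ T →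
      ∀ (𝒞 : Finset (Pt p)) (c : Pt p → Pt p), IsMinimalCover ε X 𝒞 → IsNearest X 𝒞 c →
      ∀ d : Pt p → Pt p → ℝ, IsTarget X lo hi M L r δ Δ d →
        let out := (smoothLearner 𝒞 ρ ξ T).run (tripletLabel d)
        let asked := (smoothLearner 𝒞 ρ ξ T).queries (tripletLabel d)
        let d' := switchDist θ c out.1 out.2
        let N := (Metric.coveringNumber ε X).toNat
        d' ∈ distanceModel X θ ∧
        MultTripletEquiv X ω d d' ∧
        (∀ a ∈ 𝒞, (out.2 a).PosSemidef ∧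
          ∃ τ ∈ Set.Icc (1 / hi) (1 / lo), ‖τ • hess d a - out.2 a‖ ≤ ξ) ∧
        (∀ q ∈ asked, q.1 ∈ X ∧ q.2.1 ∈ X ∪ Metric.ball q.1 r ∧
          q.2.2 ∈ X ∪ Metric.ball q.1 r) ∧
        ∀ ϑ : ℝ, 0 < ϑ →
          ϑ ≤ C'' * rate₂ C₄ ω / (p : ℝ) ^ 2 * (ξ / (D * rate₂ C₂ ω)) →
          (asked.length : ℝ) ≤
            (N : ℝ) ^ 2 * Real.logb 2 N + N * (p : ℝ) ^ 2 * Real.logb 2 (1 / ϑ) := by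
  -- The two terms are solved from (3/2)(hi²/lo) θ ≤ (lo/4) R² with R = m lo / (8 M p^(3/2)), and
  -- from (3/2)(hi²/lo) θ ≤ Δ.
  set κ : ℝ := min (lo ^ 4 / (384 * M ^ 2 * hi ^ 2)) (2 * lo * Δ / (3 * hi ^ 2)) with hκ
  have hκ0 : 0 < κ := lt_min (by positivity) (by positivity)
  set D : ℝ := min 1 (lo / 24 * (1 / hi)) with hD
  have hD0 : 0 < D := lt_min one_pos (by positivity)
  -- In order, the terms ensure Lε ≤ m lo / 24, ε ≤ δ₀ and the gap condition between ε² and θ.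
  set C : ℝ := min (min (lo / (24 * L)) (3 * lo / (2 * M))) (lo / hi * √(κ / 48)) with hC
  have hC0 : 0 < C := lt_min (lt_min (by positivity) (by positivity)) (by positivity)
  -- C' = κ / 4 makes the bound on θ an equality. C'' = D / 128 turns the condition on ϑ into ϑ ≤ ξ
  -- / (128 p²) = η / 64.
  refine ⟨D, C, κ / 4, D / 128, 1, 1, 1, 1, hD0, hC0, by positivity, by positivity, one_pos,
    one_pos, one_pos, one_pos, fun p _ ω hω => ?_⟩
  have hp1 : (1 : ℝ) ≤ p := by exact_mod_cast NeZero.one_le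
  have hp0 : (0 : ℝ) < p := one_pos.trans_le hp1
  have hp3 : (1 : ℝ) ≤ (p : ℝ) ^ 3 := one_le_pow₀ hp1
  have hp2 : (1 : ℝ) ≤ (p : ℝ) ^ 2 := one_le_pow₀ hp1
  have hPsq := rpow_three_halves_sq p
  have hP1 : (1 : ℝ) ≤ (p : ℝ) ^ (3 / 2 : ℝ) := Real.one_le_rpow hp1 (by norm_num)
  have hm0 := rate₂_one_pos hω
  have hm1 := rate₂_one_le ω
  have hmω := one_add_rate₂_le hω
  have hw1 := rate₁_one_pos hω
  have hw1m := rate₁_one_le_rate₂ hω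
  have hw3 := rate₃_one_pos hω
  have hw3m := rate₃_one_le hω
  have hw13 := rate₁_one_sq_mul_le hω
  set m := rate₂ 1 ω
  set w₁ := rate₁ 1 ω
  set w₃ := rate₃ 1 ω
  set θ : ℝ := κ * w₃ / (p : ℝ) ^ 3 with hθ
  have hθ0 : 0 < θ := by positivity
  refine ⟨θ, hθ0, le_of_eq (by rw [hθ]; ring), ?_⟩
  intro X hX δ hδ hδδ₀ r hr hXr ε hε hεC ξ hξ hξD
  refine ⟨exists_isMinimalCover hX hε, ?_⟩
  set P : ℝ := (p : ℝ) ^ (3 / 2 : ℝ) with hP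
  have hP0 : 0 < P := one_pos.trans_le hP1
  set δ₀ : ℝ := 3 * lo / (2 * M * P) with hδ₀
  have hMδ₀ : M * P * δ₀ ≤ 3 / 2 * lo := le_of_eq (by rw [hδ₀]; field_simp)
  have hξ1 : ξ ≤ 1 :=
    hξD.trans (mul_le_one₀ (min_le_left _ _) hm0.le hm1)
  set η : ℝ := ξ / (2 * (p : ℝ) ^ 2) with hη
  have hη0 : 0 < η := by positivity
  have hη1 : η ≤ 1 := by
    rw [hη, div_le_one (by positivity)]
    linarith only [hξ1, hp2]
  have hηξ : 2 * ((p : ℝ) ^ 2 * η) = ξ := by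
    rw [hη]
    field_simp
  obtain ⟨k, hk, hk'⟩ := exists_pow_two_mul_ge hη0 hη1
  -- The first term keeps all queries, of length at most 2ρ, inside the ball; the second makes the
  -- comparison error at most η / 2.
  refine ⟨min (r / 3) (η * lo / (6 * M * P)), lt_min (by positivity) (by positivity), k + 3, ?_⟩
  intro ρ hρ hρ₀ T hT 𝒞 c h𝒞 hc d hd out asked d' N
  have hρr : 2 * ρ < r := by linarith only [hρ₀.trans (min_le_left _ _), hr]
  have hρη : 3 * M * P * ρ / lo ≤ η / 2 := by
    have h1 := hρ₀.trans (min_le_right _ _)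
    rw [le_div_iff₀ (by positivity)] at h1
    rw [div_le_iff₀ hlo]
    linarith only [h1]
  have h𝒞X := h𝒞.1
  have hN : N = 𝒞.card := by
    simp only [N, ← h𝒞.2.2, ENat.toNat_natCast]
  have hmem : ∀ a ∈ 𝒞.toList, a ∈ 𝒞 := fun a ha => Finset.mem_toList.1 ha
  obtain ⟨l1, l2, l3⟩ := learnLocal_spec 𝒞.toList fun x hx =>
    hd.mahalanobisSpec hlo hM.le (h𝒞X (hmem x hx)) hρ hρr hη0 hη1 hρη hk hT
  rw [hηξ] at l1
  have hF := learnFinite_ranksFrom d 𝒞.toList 𝒞.toList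
  have hout : out = ((learnFinite 𝒞.toList 𝒞.toList).run (tripletLabel d),
      (learnLocal ρ η T 𝒞.toList).run (tripletLabel d)) := smoothLearner_run _ _ _ _ _
  have hasked : asked = (learnFinite 𝒞.toList 𝒞.toList).queries (tripletLabel d) ++
      (learnLocal ρ η T 𝒞.toList).queries (tripletLabel d) := smoothLearner_queries _ _ _ _ _
  have hA : ∀ a ∈ 𝒞, (out.2 a).PosSemidef ∧
      ∃ τ ∈ Set.Icc (1 / hi) (1 / lo), ‖τ • hess d a - out.2 a‖ ≤ ξ := fun a ha => by
    rw [hout]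
    exact l1 a (Finset.mem_toList.2 ha)
  have hf : ∀ a ∈ 𝒞, RanksFrom 𝒞.toList d out.1 a := fun a ha => by
    rw [hout]
    exact hF a (Finset.mem_toList.2 ha)
  refine ⟨⟨𝒞, c, out.1, out.2, h𝒞X, hc,
    ⟨fun x hx y _ => (hf x hx).nonneg y, fun x hx => (hf x hx).self⟩, fun a ha => (hA a ha).1,
    fun x _ y _ => rfl⟩, ?_, hA, ?_, ?_⟩
  · have hεm : (ε : ℝ) ≤ C * m := hεC.trans <| (div_le_self (by positivity) hP1).trans <|
      mul_le_mul_of_nonneg_left hw1m hC0.le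
    have hC1 : C ≤ lo / (24 * L) := (min_le_left _ _).trans (min_le_left _ _)
    have hC2 : C ≤ 3 * lo / (2 * M) := (min_le_left _ _).trans (min_le_right _ _)
    have hC3 : C ^ 2 ≤ lo ^ 2 / hi ^ 2 * (κ / 48) := by
      calc C ^ 2 ≤ (lo / hi * √(κ / 48)) ^ 2 := pow_le_pow_left₀ hC0.le (min_le_right _ _) 2
        _ = _ := by rw [mul_pow, Real.sq_sqrt (by positivity), div_pow]
    have hθκ : θ ≤ κ := by
      refine (div_le_self (by positivity) hp3).trans (mul_le_of_le_one_right hκ0.le ?_)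
      exact hw3m.trans (pow_le_one₀ hm0.le hm1)
    refine multTripletEquiv_switchDist (m := m) (δ₀ := δ₀) (ξ := ξ) (ε := ε)
      (R := m * lo / (8 * M * P)) hd hlo hhi hM hL.le hω hm0 hm1 hmω hδδ₀ hMδ₀ hXr (by positivity)
      (le_of_eq (by rw [← hP]; field_simp)) ?_ ?_ ?_ ?_ hθ0 ?_ ?_ ?_ h𝒞X (fun x hx => (hc x hx).1)
      (fun x hx => h𝒞.norm_sub_nearest_le hc hx) hf (fun a ha => (hA a ha).2)
    · rw [hδ₀, div_le_div_iff₀ (by positivity) (by positivity)]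
      have : m * (lo * M * P) ≤ 1 * (lo * M * P) := by gcongr
      have h0 : 0 < lo * M * P := by positivity
      linarith only [this, h0]
    · refine hξD.trans ((mul_le_mul_of_nonneg_right (min_le_right _ _) hm0.le).trans_eq ?_)
      ring
    · calc L * (ε : ℝ) ≤ L * (lo / (24 * L) * m) := by
            refine mul_le_mul_of_nonneg_left (hεm.trans ?_) hL.le
            exact mul_le_mul_of_nonneg_right hC1 hm0.le
        _ = m * lo / 24 := by field_simp
    · calc (ε : ℝ) ≤ C * w₁ / P := hεC
        _ ≤ 3 * lo / (2 * M) * 1 / P := by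
            have : w₁ ≤ 1 := hw1m.trans hm1
            gcongr
        _ = δ₀ := by rw [hδ₀]; field_simp
    · have h1 : θ ≤ lo ^ 4 / (384 * M ^ 2 * hi ^ 2) * m ^ 2 / (p : ℝ) ^ 3 := by
        rw [hθ]
        have : κ ≤ lo ^ 4 / (384 * M ^ 2 * hi ^ 2) := min_le_left _ _
        gcongr
      refine (mul_le_mul_of_nonneg_left h1 (by positivity)).trans_eq ?_
      rw [div_pow, mul_pow (8 * M) P, hPsq]
      field_simp
      norm_num
    · refine (mul_le_mul_of_nonneg_left (hθκ.trans (min_le_right _ _)) (by positivity)).trans_eq ?_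
      field_simp
    · have h1 : (ε : ℝ) ^ 2 ≤ C ^ 2 * w₁ ^ 2 / (p : ℝ) ^ 3 := by
        rw [← hPsq, ← mul_pow, ← div_pow]
        exact pow_le_pow_left₀ ε.coe_nonneg hεC 2
      calc 3 * hi * (ε : ℝ) ^ 2 * (1 + ω)
          ≤ 3 * hi * (C ^ 2 * w₁ ^ 2 / (p : ℝ) ^ 3) * (1 + ω) := by gcongr
        _ = 3 * hi * C ^ 2 / (p : ℝ) ^ 3 * (w₁ ^ 2 * (1 + ω)) := by ring
        _ ≤ 3 * hi * C ^ 2 / (p : ℝ) ^ 3 * (2 * ω * w₃) := by gcongr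
        _ ≤ 3 * hi * (lo ^ 2 / hi ^ 2 * (κ / 48)) / (p : ℝ) ^ 3 * (2 * ω * w₃) := by gcongr
        _ = ω * (lo ^ 2 / (8 * hi) * θ) := by
            rw [hθ]
            field_simp
            norm_num
  · intro q hq
    rw [hasked, List.mem_append] at hq
    rcases hq with hq | hq
    · obtain ⟨h1, h2, h3⟩ := learnFinite_queries_mem d 𝒞.toList 𝒞.toList q hq
      exact ⟨h𝒞X (hmem _ h1), .inl (h𝒞X (hmem _ h2)), .inl (h𝒞X (hmem _ h3))⟩
    · obtain ⟨h1, h2, h3⟩ := l3 q hq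
      exact ⟨h𝒞X (hmem _ h1), .inr h2, .inr h3⟩
  · intro ϑ hϑ hϑξ
    have hf' := learnFinite_length_queries d 𝒞.toList 𝒞.toList
    rw [Finset.length_toList, ← hN] at hf' l2
    refine length_queries_le (η := η) (k := k) (by rw [hasked, List.length_append, Nat.cast_add])
      hf' (by exact_mod_cast l2) hk' hη0 hϑ (hϑξ.trans_eq ?_)
    rw [hη]
    field_simp
    norm_num
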